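/- Let $d>1$ be an integer and $n=(n_1,\dots,n_d)\in\mathbb N^d$ (zero entries allowed). Let $H^2(\mathbb T^d)$ be the space of $f\in L^2(\mathbb T^d)$ with $\hat f(k)=0$ whenever some $k_j<0$, and for $j=1,\dots,d$ let $H^2_{x_j}$ be the space of $f\in L^2(\mathbb T^d)$ with $\hat f(k)=0$ whenever $k_j<0$; let $P$ and $P_{x_j}$ be the orthogonal projections of $L^2(\mathbb T^d)$ onto $H^2(\mathbb T^d)$ and $H^2_{x_j}$. A function $\phi\in L^2(\mathbb T^d)$ is in $\mathrm{BMO}_r(\mathbb T^d)$ if there are $\varphi_0,\dots,\varphi_d\in L^\infty(\mathbb T^d)$ with $$(I-P_{x_j})\phi=(I-P_{x_j})\varphi_j\quad(j=1,\dots,d),\qquad P_{x_1}\cdots P_{x_d}\phi=P_{x_1}\cdots P_{x_d}\varphi_0;$$ $\|\phi\|_{\mathrm{BMO}_r}$ is the infimum of $\max_{0\le j\le d}\|\varphi_j\|_\infty$ over all such $\varphi_0,\dots,\varphi_d$ (and $+\infty$ if there are none). Put $\mathrm{BMOA}_r=\mathrm{BMO}_r(\mathbb T^d)\cap H^2(\mathbb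 T^d)$. For $\phi\in\mathrm{BMO}_r(\mathbb T^d)$ let $\Gamma_\phi:H^2(\mathbb T^d)\to H^2(\mathbb T^d)^\perp$ be the Hankel operator with symbol $\phi$, i.e. the unique bounded linear operator with $\Gamma_\phi p=(I-P)(\phi p)$ for every trigonometric polynomial $p\in H^2(\mathbb T^d)$. Let $$\sigma_n(\Gamma_\phi)=\inf\|\Gamma_\phi|_{\mathcal I}\|,$$ the infimum being over all subspaces $\mathcal I\subset H^2(\mathbb T^d)$ that are invariant under the shifts $S_jf(x)=e^{ix_j}f(x)$, $j=1,\dots,d$, and of finite multi-codimension $n$, i.e. of the form $\mathcal I=V_1\otimes\cdots\otimes V_d$ (closed linear span of the products $f_1(x_1)\cdots f_d(x_d)$, $f_k\in V_k$) with $V_k$ a closed subspace of codimension $n_k$ in $H^2(\mathbb T)$. Let $$\delta(\phi,\mathrm{BMOA}_r+R_n)=\inf\|b\phi-h\|_{\mathrm{BMO}_r},$$ the infimum being over all $h\in\mathrm{BMOA}_r$ and all $b(x)=b_1(x_1)\cdots b_d(x_d)$, with $b_k$ a one-variable Blaschke product $c\prod_i\frac{z-a_i}{1-\bar a_iz}$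 ($|c|=1$, $|a_i|<1$, $z=e^{ix_k}$) of at most $n_k$ factors. **Theorem.** For every $\phi\in\mathrm{BMO}_r(\mathbb T^d)$ the operator $\Gamma_\phi$ exists and is unique, $\sigma_n(\Gamma_\phi)<\infty$, and $$\frac1{\sqrt d}\,\sigma_n(\Gamma_\phi)\le\delta(\phi,\mathrm{BMOA}_r+R_n)\le\sigma_n(\Gamma_\phi).$$ -/

import Mathlib

open MeasureTheory
open scoped ENNReal ComplexConjugate

noncomputable section

/-- Normalized Lebesgue (Haar) measure on the torus `𝕋^d`, where `𝕋 = ℝ / ℤ` is the domain of the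
characters `x ↦ exp (2 π i k x)`. -/
abbrev torusMeasure (d : ℕ) : Measure (UnitAddTorus (Fin d)) :=
  Measure.pi fun _ => AddCircle.haarAddCircle

/-- The Hilbert space `L²(𝕋^d)`. -/
abbrev L2Torus (d : ℕ) : Type := Lp ℂ 2 (torusMeasure d)

/-- The Hilbert space `L²(𝕋)` in one variable. -/
abbrev L2Circle : Type := Lp ℂ 2 (AddCircle.haarAddCircle : Measure UnitAddCircle)

lemma mFourierCoeff_eq_inner {d : ℕ} (f : L2Torus d) (k : Fin d → ℤ) :
    UnitAddTorus.mFourierCoeff f k = inner ℂ (UnitAddTorus.mFourierLp 2 k : L2Torus d) f := by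
  have h1 := UnitAddTorus.mFourierBasis_repr f k
  rw [← h1, HilbertBasis.repr_apply_apply, UnitAddTorus.coe_mFourierBasis]

lemma fourierCoeff_eq_inner (f : L2Circle) (k : ℤ) :
    fourierCoeff f k = inner ℂ (fourierLp 2 k : L2Circle) f := by
  rw [← fourierBasis_repr f k, HilbertBasis.repr_apply_apply, coe_fourierBasis]

/-- The subspace of the `f ∈ L²(𝕋^d)` whose Fourier coefficients vanish off `Λ ⊆ ℤ^d`. -/
def spectralSubspace {d : ℕ} (Λ : Set (Fin d → ℤ)) : Submodule ℂ (L2Torus d) where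
  carrier := {f | ∀ k, k ∉ Λ → UnitAddTorus.mFourierCoeff f k = 0}
  zero_mem' k _ := by rw [mFourierCoeff_eq_inner, inner_zero_right]
  add_mem' {f g} hf hg k hk := by
    have h1 := hf k hk
    have h2 := hg k hk
    rw [mFourierCoeff_eq_inner] at h1 h2 ⊢
    rw [inner_add_right, h1, h2, add_zero]
  smul_mem' c f hf k hk := by
    have h1 := hf k hk
    rw [mFourierCoeff_eq_inner] at h1 ⊢
    rw [inner_smul_right, h1, mul_zero]

lemma isClosed_spectralSubspace {d : ℕ} (Λ : Set (Fin d → ℤ)) :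
    IsClosed (spectralSubspace Λ : Set (L2Torus d)) := by
  have h : (spectralSubspace Λ : Set (L2Torus d)) =
      ⋂ k ∈ Λᶜ, {f | inner ℂ (UnitAddTorus.mFourierLp 2 k : L2Torus d) f = 0} := by
    ext f
    simp only [Set.mem_iInter, Set.mem_compl_iff, ← mFourierCoeff_eq_inner]
    rfl
  rw [h]
  exact isClosed_biInter fun k _ =>
    isClosed_eq (continuous_const.inner continuous_id) continuous_const

instance {d : ℕ} (Λ : Set (Fin d → ℤ)) : CompleteSpace (spectralSubspace Λ) :=
  (isClosed_spectralSubspace Λ).completeSpace_coe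

/-- The Hardy space `H²(𝕋^d)`. -/
abbrev hardy (d : ℕ) : Submodule ℂ (L2Torus d) := spectralSubspace {k | ∀ j, 0 ≤ k j}

/-- The space `H²_{x_j}` of the functions in `L²(𝕋^d)` that are analytic in `x_j`. -/
abbrev hardyIn {d : ℕ} (j : Fin d) : Submodule ℂ (L2Torus d) := spectralSubspace {k | 0 ≤ k j}

/-- The Hardy space `H²(𝕋)` of one variable. -/
def hardyCircle : Submodule ℂ L2Circle where
  carrier := {f | ∀ k < 0, fourierCoeff f k = 0}
  zero_mem' k _ := by rw [fourierCoeff_eq_inner, inner_zero_right]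
  add_mem' {f g} hf hg k hk := by
    have h1 := hf k hk
    have h2 := hg k hk
    rw [fourierCoeff_eq_inner] at h1 h2 ⊢
    rw [inner_add_right, h1, h2, add_zero]
  smul_mem' c f hf k hk := by
    have h1 := hf k hk
    rw [fourierCoeff_eq_inner] at h1 ⊢
    rw [inner_smul_right, h1, mul_zero]

/-- The analytic projector `P : L² → H²(𝕋^d)`. -/
def projH2 (d : ℕ) : L2Torus d →L[ℂ] L2Torus d := (hardy d).starProjection

/-- The analytic projector `P_{x_j} : L² → H²_{x_j}` in the variable `x_j`. -/
def projIn {d : ℕ} (j : Fin d) : L2Torus d →L[ℂ] L2Torus d := (hardyIn j).starProjection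

/-- The composition `P_{x_1} P_{x_2} ⋯ P_{x_d}`. -/
def projAll (d : ℕ) : L2Torus d →L[ℂ] L2Torus d := (List.ofFn fun j : Fin d => projIn j).prod

/-- The product `g φ` of a continuous function `g` with `φ ∈ L²(𝕋^d)`. -/
def mulL2 {d : ℕ} (g : C(UnitAddTorus (Fin d), ℂ)) (φ : L2Torus d) : L2Torus d :=
  MemLp.toLp (fun x => g x * φ x) (MemLp.mul' (Lp.memLp φ)
    (MemLp.of_bound g.continuous.aestronglyMeasurable ‖g‖
      (Filter.Eventually.of_forall g.norm_coe_le_norm) : MemLp g ∞ (torusMeasure d)))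

/-- The shift `S_j f (x) = exp (i x_j) f (x)`. -/
def shift {d : ℕ} (j : Fin d) (f : L2Torus d) : L2Torus d :=
  mulL2 (UnitAddTorus.mFourier (Pi.single j 1)) f

/-- `φ₀, φ₁, …, φ_d` (the last `d` of them given by `ϕ`) are bounded functions with
`(I - P_{x_j}) φ = (I - P_{x_j}) φ_j` for `j = 1, …, d` and
`P_{x_1} ⋯ P_{x_d} φ = P_{x_1} ⋯ P_{x_d} φ₀`. -/
structure IsBMOrDecomp {d : ℕ} (φ φ₀ : L2Torus d) (ϕ : Fin d → L2Torus d) : Prop where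
  memLp_zero : MemLp φ₀ ∞ (torusMeasure d)
  memLp : ∀ j, MemLp (ϕ j) ∞ (torusMeasure d)
  antianalytic : ∀ j, φ - projIn j φ = ϕ j - projIn j (ϕ j)
  analytic : projAll d φ = projAll d φ₀

/-- `φ ∈ L²(𝕋^d)` has restricted bounded mean oscillation. -/
def MemBMOr {d : ℕ} (φ : L2Torus d) : Prop := ∃ φ₀ ϕ, IsBMOrDecomp φ φ₀ ϕ

/-- The norm of `BMO_r(𝕋^d)`, the infimum of `max_{0 ≤ j ≤ d} ‖φ_j‖_∞` over all decompositions.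
It is `∞` off `BMO_r(𝕋^d)`. -/
def bmorNorm {d : ℕ} (φ : L2Torus d) : ℝ≥0∞ :=
  ⨅ (φ₀ : L2Torus d) (ϕ : Fin d → L2Torus d) (_ : IsBMOrDecomp φ φ₀ ϕ),
    max (eLpNorm φ₀ ∞ (torusMeasure d)) (⨆ j, eLpNorm (ϕ j) ∞ (torusMeasure d))

/-- `BMOA_r(𝕋^d) = BMO_r(𝕋^d) ∩ H²(𝕋^d)`. -/
def MemBMOAr {d : ℕ} (h : L2Torus d) : Prop := MemBMOr h ∧ h ∈ hardy d

/-- The analytic trigonometric polynomials, `𝒫(𝕋^d) ∩ H²(𝕋^d)`. -/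
def analyticPoly (d : ℕ) : Submodule ℂ C(UnitAddTorus (Fin d), ℂ) :=
  Submodule.span ℂ (UnitAddTorus.mFourier '' {k | ∀ j, 0 ≤ k j})

/-- `Γ` is the bounded (big) Hankel operator `Γ_φ : H²(𝕋^d) → H²(𝕋^d)^⊥` with symbol `φ`: the
bounded operator with `Γ p = (I - P) (φ p)` for all analytic trigonometric polynomials `p`. -/
def IsHankelWithSymbol {d : ℕ} (φ : L2Torus d) (Γ : hardy d →L[ℂ] (hardy d)ᗮ) : Prop :=
  ∀ p ∈ analyticPoly d, ∀ f : hardy d, (f : UnitAddTorus (Fin d) → ℂ) =ᵐ[torusMeasure d] p →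
    (Γ f : L2Torus d) = mulL2 p φ - projH2 d (mulL2 p φ)

/-- The closed tensor product `V_1 ⊗ ⋯ ⊗ V_d ⊆ L²(𝕋^d)` of subspaces of `H²(𝕋)`: the closed span
of the functions `f_1(x_1) ⋯ f_d(x_d)` with `f_k ∈ V_k`. -/
def tensorSubspace {d : ℕ} (V : Fin d → Submodule ℂ hardyCircle) : Submodule ℂ (L2Torus d) :=
  (Submodule.span ℂ {F : L2Torus d | ∃ f : Fin d → hardyCircle, (∀ k, f k ∈ V k) ∧
    F =ᵐ[torusMeasure d] fun x => ∏ k, (f k : L2Circle) (x k)}).topologicalClosure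

/-- `I ⊆ H²(𝕋^d)` is of finite multi-codimension `n = (n_1, …, n_d)`: it is `V_1 ⊗ ⋯ ⊗ V_d` for
closed subspaces `V_k` of codimension `n_k` in `H²(𝕋)`. -/
def HasMultiCodim {d : ℕ} (I : Submodule ℂ (hardy d)) (n : Fin d → ℕ) : Prop :=
  ∃ V : Fin d → Submodule ℂ hardyCircle,
    (∀ k, IsClosed (V k : Set hardyCircle)) ∧
    (∀ k, Module.rank ℂ (hardyCircle ⧸ V k) = n k) ∧
    I.map (hardy d).subtype = tensorSubspace V

/-- `I ⊆ H²(𝕋^d)` is invariant under the shifts `S_1, …, S_d`. -/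
def ShiftInvariant {d : ℕ} (I : Submodule ℂ (hardy d)) : Prop :=
  ∀ j, ∀ f ∈ I.map (hardy d).subtype, shift j f ∈ I.map (hardy d).subtype

/-- The sigma number `σ_n(Γ)`: the infimum of `‖Γ|_I‖` over the shift-invariant subspaces `I` of
`H²(𝕋^d)` of finite multi-codimension `n`. -/
def sigmaNumber {d : ℕ} (n : Fin d → ℕ) (Γ : hardy d →L[ℂ] (hardy d)ᗮ) : ℝ≥0∞ :=
  ⨅ (I : Submodule ℂ (hardy d)) (_ : ShiftInvariant I) (_ : HasMultiCodim I n),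
    ‖Γ.comp I.subtypeL‖ₑ

/-- The Blaschke factor `(z - a) / (1 - conj a * z)` on the circle, with `z = exp (2 π i t)`. -/
def blaschkeFactor (a : Complex.UnitDisc) : C(UnitAddCircle, ℂ) where
  toFun t := (fourier 1 t - (a : ℂ)) / (1 - conj (a : ℂ) * fourier 1 t)
  continuous_toFun := by
    refine Continuous.div (by fun_prop) (by fun_prop) fun t h => ?_
    have h1 : conj (a : ℂ) * fourier 1 t = 1 := (sub_eq_zero.mp h).symm
    have h2 := congrArg norm h1
    rw [norm_mul, RCLike.norm_conj, fourier_apply, Circle.norm_coe, mul_one, norm_one] at h2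
    exact a.norm_ne_one h2

/-- `b` is a (finite) Blaschke product of one variable with at most `N` factors. -/
def IsBlaschkeProduct (N : ℕ) (b : C(UnitAddCircle, ℂ)) : Prop :=
  ∃ (c : Circle) (s : Multiset Complex.UnitDisc), s.card ≤ N ∧
    b = (c : ℂ) • (s.map blaschkeFactor).prod

/-- The tensor product `b_1 ⊗ ⋯ ⊗ b_d`, that is, `b_1(x_1) ⋯ b_d(x_d)`. -/
def tensorFun {d : ℕ} (b : Fin d → C(UnitAddCircle, ℂ)) : C(UnitAddTorus (Fin d), ℂ) :=
  ∏ k, (b k).comp (ContinuousMap.eval k)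

/-- `δ(φ, BMOA_r + R_n)`: the infimum of `‖b φ - h‖_{BMO_r}` over `h ∈ BMOA_r` and
`b = b_1 ⊗ ⋯ ⊗ b_d` with `b_k` a Blaschke product of at most `n_k` factors. -/
def deltaDist {d : ℕ} (n : Fin d → ℕ) (φ : L2Torus d) : ℝ≥0∞ :=
  ⨅ (b : Fin d → C(UnitAddCircle, ℂ)) (_ : ∀ k, IsBlaschkeProduct (n k) (b k))
    (h : L2Torus d) (_ : MemBMOAr h), bmorNorm (mulL2 (tensorFun b) φ - h)

end

/-!
The Hankel operator sees only the part `(I - P) φ` of its symbol, which is controlled by the `d`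
pieces `(I - P_{x_j}) φ`, and each piece is the subject of a Nehari theorem in one variable.

*Existence.* For `p ∈ H²(𝕋^d)` the piece `(I - P_{x_j}) (p φ)` equals `(I - P_{x_j}) (p φ_j)` with
`φ_j` bounded, so a decomposition of `φ` bounded by `M` gives a Hankel operator bounded by `√d M`
(`norm_sub_projH2_le`), as the squares of the `d` pieces dominate the square of the norm of
`(I - P) (p φ)`.

*Lower bound for `δ`.* If `b φ - h` has a decomposition bounded by `M`, then `Γ (b p)` is
`(I - P) ((b φ - h) p)`, so `Γ` is bounded by `√d M` on `b H²(𝕋^d)`. If `b_k` has fewer than `n_k`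
factors, it is multiplied by a power of `z`. Then `b_k H²(𝕋)` is of codimension `n_k`
(`rank_quotient_range_mulHardy`), and the tensor product of these spaces is a competitor in the
definition of `σ_n` (`exists_shiftInvariant_hasMultiCodim`).

*Upper bound for `δ`.* If `I = V_1 ⊗ ⋯ ⊗ V_d` is shift-invariant, then each `V_k` is invariant
under the shift of `H²(𝕋)` (`shiftHardy_mem_of_shift_mem`), so by Beurling's theorem it contains
`b_k H²(𝕋)` for a Blaschke product `b_k` of at most `n_k` factors
(`exists_blaschkeProduct_mul_mem`). In finite codimension this is an induction: the transposed shift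
has an eigenvector on the annihilator of `V_k`, its eigenvalue is in the open disc, and `V_k` is
divisible by the corresponding Blaschke factor. Hence the Hankel operator with symbol `b φ`
is bounded by the norm `M` of `Γ` on `I`. As
`I - P_{x_j}` commutes with the characters in the other variables, `p ↦ (I - P_{x_j}) (p b φ)` is
then bounded by `M` on all polynomials analytic in `x_j`, and Nehari's theorem in the variable `x_j`
(`exists_bounded_of_norm_sub_projIn_le`) gives `ψ_j` bounded by `M` with
`(I - P_{x_j}) b φ = (I - P_{x_j}) ψ_j`. With `h = P (b φ)`, the functions `0, ψ_1, …, ψ_d`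
decompose `b φ - h`.

That `h` belongs to `BMO_r` needs a bounded `ψ₀` with `P b φ = P ψ₀`, that is, the stability of
`BMO_r` under multiplication by Blaschke products (`MemBMOr.mulOp_tensorFun`). Nehari's theorem
follows by duality from the factorization of a trigonometric polynomial as a product of two
functions of equal modulus, one analytic and one antianalytic in `x_j`, up to a small error
(`exists_factorization`).
-/

noncomputable section

/-! ### Multiplication by continuous functions -/

/-- `1 - c S` is onto for a contraction `S` of a Banach space and `|c| < 1`. -/
lemma exists_sub_smul_apply_eq {E : Type*} [NormedAddCommGroup E] [NormedSpace ℂ E]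
    [CompleteSpace E] {S : E →L[ℂ] E} (hS : ‖S‖ ≤ 1) {c : ℂ} (hc : ‖c‖ < 1) (f : E) :
    ∃ u, u - c • S u = f := by
  have h1 : ‖c • S‖ < 1 := by
    rw [norm_smul]
    exact (mul_le_of_le_one_right (norm_nonneg c) hS).trans_lt hc
  obtain ⟨w, hw⟩ := isUnit_one_sub_of_norm_lt_one h1
  refine ⟨w⁻¹.1 f, ?_⟩
  have h2 : (w.1 * w⁻¹.1) f = f := by rw [Units.mul_inv]; rfl
  rw [hw] at h2
  exact h2

section Multiplication

variable {α : Type*} [TopologicalSpace α] [CompactSpace α] [MeasurableSpace α] [BorelSpace α]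
  (μ : Measure α) [IsFiniteMeasure μ]

/-- Multiplication by a continuous function, as an operator on `L²(μ)`. -/
def mulOp : C(α, ℂ) →L[ℂ] Lp ℂ 2 μ →L[ℂ] Lp ℂ 2 μ :=
  ((ContinuousLinearMap.mul ℂ ℂ).holderL μ ∞ 2 2).comp (ContinuousMap.toLp ∞ μ ℂ)

variable {μ}

lemma coeFn_mulOp (g : C(α, ℂ)) (f : Lp ℂ 2 μ) : mulOp μ g f =ᵐ[μ] fun x => g x * f x := by
  have h1 := (ContinuousLinearMap.mul ℂ ℂ).coeFn_holder (r := 2)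
    (ContinuousMap.toLp (E := ℂ) ∞ μ ℂ g) f
  refine h1.trans ?_
  filter_upwards [ContinuousMap.coeFn_toLp (p := ∞) (𝕜 := ℂ) μ g] with x hx
  rw [ContinuousLinearMap.mul_apply', hx]

lemma mulOp_eq_iff (g : C(α, ℂ)) (f F : Lp ℂ 2 μ) :
    mulOp μ g f = F ↔ (fun x => g x * f x) =ᵐ[μ] F :=
  ⟨fun h => h ▸ (coeFn_mulOp g f).symm, fun h => Lp.ext ((coeFn_mulOp g f).trans h)⟩

lemma mulOp_mul (g h : C(α, ℂ)) (f : Lp ℂ 2 μ) :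
    mulOp μ (g * h) f = mulOp μ g (mulOp μ h f) := by
  rw [mulOp_eq_iff]
  filter_upwards [coeFn_mulOp g (mulOp μ h f), coeFn_mulOp h f] with x h1 h2
  rw [h1, h2, ContinuousMap.mul_apply, mul_assoc]

lemma mulOp_comm (g h : C(α, ℂ)) (f : Lp ℂ 2 μ) :
    mulOp μ g (mulOp μ h f) = mulOp μ h (mulOp μ g f) := by
  rw [← mulOp_mul, mul_comm, mulOp_mul]

@[simp]
lemma mulOp_one (f : Lp ℂ 2 μ) : mulOp μ 1 f = f := by
  rw [mulOp_eq_iff]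
  simp

lemma mulOp_toLp (g h : C(α, ℂ)) :
    mulOp μ g (ContinuousMap.toLp 2 μ ℂ h) = ContinuousMap.toLp 2 μ ℂ (g * h) := by
  rw [mulOp_eq_iff]
  filter_upwards [ContinuousMap.coeFn_toLp (p := 2) (𝕜 := ℂ) μ h,
    ContinuousMap.coeFn_toLp (p := 2) (𝕜 := ℂ) μ (g * h)] with x h1 h2
  rw [h1, h2, ContinuousMap.mul_apply]

lemma inner_mulOp_left (g : C(α, ℂ)) (f h : Lp ℂ 2 μ) :
    inner ℂ (mulOp μ g f) h = inner ℂ f (mulOp μ (star g) h) := by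
  rw [L2.inner_def, L2.inner_def]
  refine integral_congr_ae ?_
  filter_upwards [coeFn_mulOp g f, coeFn_mulOp (star g) h] with x h1 h2
  rw [h1, h2]
  simp only [RCLike.inner_apply, map_mul, ContinuousMap.star_apply, RCLike.star_def]
  ring

lemma inner_mulOp_right (g : C(α, ℂ)) (f h : Lp ℂ 2 μ) :
    inner ℂ f (mulOp μ g h) = inner ℂ (mulOp μ (star g) f) h := by
  rw [inner_mulOp_left, star_star]

lemma norm_mulOp_of_norm_one {g : C(α, ℂ)} (hg : ∀ x, ‖g x‖ = 1) (f : Lp ℂ 2 μ) :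
    ‖mulOp μ g f‖ = ‖f‖ := by
  refine le_antisymm ?_ ?_ <;> refine Lp.norm_le_norm_of_ae_le ?_ <;>
    filter_upwards [coeFn_mulOp g f] with x h1 <;> rw [h1, norm_mul, hg, one_mul]

lemma memLp_top_mulOp (g : C(α, ℂ)) {f : Lp ℂ 2 μ} (hf : MemLp f ∞ μ) :
    MemLp (mulOp μ g f) ∞ μ := by
  refine (memLp_congr_ae (coeFn_mulOp g f)).2 ?_
  exact MemLp.mul' hf (MemLp.of_bound g.continuous.aestronglyMeasurable ‖g‖
      (Filter.Eventually.of_forall g.norm_coe_le_norm) : MemLp g ∞ μ)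

lemma norm_mulOp_le_of_eLpNorm_le (g : C(α, ℂ)) {f : Lp ℂ 2 μ} {M : ℝ} (hM : 0 ≤ M)
    (hf : eLpNorm f ∞ μ ≤ ENNReal.ofReal M) :
    ‖mulOp μ g f‖ ≤ M * ‖ContinuousMap.toLp 2 μ ℂ g‖ := by
  have h1 : ∀ᵐ x ∂μ, ‖f x‖ ≤ M := by
    rw [eLpNorm_exponent_top] at hf
    filter_upwards [ae_le_eLpNormEssSup (f := f) (μ := μ)] with x hx
    have := hx.trans hf
    rwa [← ofReal_norm, ENNReal.ofReal_le_ofReal_iff hM] at this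
  rw [← abs_of_nonneg hM, ← Real.norm_eq_abs, ← norm_smul]
  refine Lp.norm_le_norm_of_ae_le ?_
  filter_upwards [h1, coeFn_mulOp g f, ContinuousMap.coeFn_toLp (p := 2) (𝕜 := ℂ) μ g,
    Lp.coeFn_smul M (ContinuousMap.toLp (E := ℂ) 2 μ ℂ g)] with x h1 h2 h3 h4
  rw [h4, Pi.smul_apply, h2, h3, norm_mul, norm_smul, mul_comm, Real.norm_of_nonneg hM]
  gcongr

/-- On a closed subspace invariant under a unimodular function `ζ`, multiplication by `1 - c ζ`
is onto as soon as `|c| < 1`. -/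
lemma exists_sub_smul_mulOp_eq {K : Submodule ℂ (Lp ℂ 2 μ)} [CompleteSpace K] {ζ : C(α, ℂ)}
    (hζ : ∀ x, ‖ζ x‖ = 1) (hK : ∀ f ∈ K, mulOp μ ζ f ∈ K) {c : ℂ} (hc : ‖c‖ < 1)
    {f : Lp ℂ 2 μ} (hf : f ∈ K) : ∃ u ∈ K, u - c • mulOp μ ζ u = f := by
  let S : K →L[ℂ] K := (mulOp μ ζ).restrict hK
  have hS : ‖S‖ ≤ 1 := S.opNorm_le_bound zero_le_one fun x => by
    rw [one_mul]
    exact (norm_mulOp_of_norm_one hζ (x : Lp ℂ 2 μ)).le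
  obtain ⟨u, hu⟩ := exists_sub_smul_apply_eq hS hc ⟨f, hf⟩
  exact ⟨u, u.2, congrArg Subtype.val hu⟩

lemma mulOp_sub_smul_mulOp {β ζ : C(α, ℂ)} {a c : ℂ} (h : β * (1 - c • ζ) = ζ - a • 1)
    (u : Lp ℂ 2 μ) : mulOp μ β (u - c • mulOp μ ζ u) = mulOp μ ζ u - a • u := by
  have h1 : u - c • mulOp μ ζ u = mulOp μ (1 - c • ζ) u := by simp [mulOp_one]
  rw [h1, ← mulOp_mul, h]
  simp [mulOp_one]

/-- A closed subspace invariant under a unimodular function `ζ` is invariant under the functions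
`(ζ - a) / (1 - conj a * ζ)`, where `|a| < 1`. -/
lemma mulOp_mem_of_one_sub_smul_mul {K : Submodule ℂ (Lp ℂ 2 μ)} [CompleteSpace K]
    {ζ β : C(α, ℂ)} (hζ : ∀ x, ‖ζ x‖ = 1) (hK : ∀ f ∈ K, mulOp μ ζ f ∈ K) {a c : ℂ}
    (hc : ‖c‖ < 1) (hβ : β * (1 - c • ζ) = ζ - a • 1) {f : Lp ℂ 2 μ} (hf : f ∈ K) :
    mulOp μ β f ∈ K := by
  obtain ⟨u, hu, rfl⟩ := exists_sub_smul_mulOp_eq hζ hK hc hf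
  rw [mulOp_sub_smul_mulOp hβ]
  exact K.sub_mem (hK u hu) (K.smul_mem a hu)

end Multiplication

/-! ### Fourier analysis on the torus -/

section Torus

variable {d : ℕ}

/-- The character `x ↦ exp (2 π i k · x)` as an element of `L²(𝕋^d)`. -/
def torusChar (k : Fin d → ℤ) : L2Torus d := UnitAddTorus.mFourierLp 2 k

lemma torusChar_eq_toLp (k : Fin d → ℤ) :
    torusChar k = ContinuousMap.toLp 2 (torusMeasure d) ℂ (UnitAddTorus.mFourier k) := rfl

lemma mFourierCoeff_eq_inner_torusChar (f : L2Torus d) (k : Fin d → ℤ) :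
    UnitAddTorus.mFourierCoeff f k = inner ℂ (torusChar k) f := mFourierCoeff_eq_inner f k

/-- The Hilbert basis of `L²(𝕋^d)` that consists of the characters. -/
def torusBasis (d : ℕ) : HilbertBasis (Fin d → ℤ) ℂ (L2Torus d) := UnitAddTorus.mFourierBasis

lemma coe_torusBasis : ⇑(torusBasis d) = torusChar := UnitAddTorus.coe_mFourierBasis

lemma inner_torusChar_torusChar (k l : Fin d → ℤ) :
    inner ℂ (torusChar k) (torusChar l) = if k = l then (1 : ℂ) else 0 := by
  have h := orthonormal_iff_ite.1 (torusBasis d).orthonormal k l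
  rwa [coe_torusBasis] at h

lemma ext_inner_torusChar {f g : L2Torus d}
    (h : ∀ k, inner ℂ (torusChar k) f = inner ℂ (torusChar k) g) : f = g := by
  refine (torusBasis d).repr.injective (lp.ext (funext fun k => ?_))
  rw [HilbertBasis.repr_apply_apply, HilbertBasis.repr_apply_apply, coe_torusBasis]
  exact h k

lemma hasSum_norm_inner_torusChar_sq (f : L2Torus d) :
    HasSum (fun k => ‖inner ℂ (torusChar k) f‖ ^ 2) (‖f‖ ^ 2) := by
  have h := (torusBasis d).hasSum_inner_mul_inner f f
  rw [coe_torusBasis, inner_self_eq_norm_sq_to_K] at h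
  have h2 := RCLike.hasSum_re ℂ h
  convert h2 using 1
  · ext k
    rw [inner_mul_symm_re_eq_norm, norm_mul, norm_inner_symm, sq]
  · norm_cast

lemma mem_spectralSubspace {Λ : Set (Fin d → ℤ)} {f : L2Torus d} :
    f ∈ spectralSubspace Λ ↔ ∀ k ∉ Λ, inner ℂ (torusChar k) f = 0 :=
  forall₂_congr fun k _ => by rw [mFourierCoeff_eq_inner_torusChar]

lemma spectralSubspace_mono {Λ Λ' : Set (Fin d → ℤ)} (h : Λ ⊆ Λ') :
    spectralSubspace Λ ≤ spectralSubspace Λ' := fun _ hf k hk => hf k fun h' => hk (h h')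

lemma torusChar_mem {Λ : Set (Fin d → ℤ)} {k : Fin d → ℤ} (hk : k ∈ Λ) :
    torusChar k ∈ spectralSubspace Λ := by
  rw [mem_spectralSubspace]
  intro l hl
  rw [inner_torusChar_torusChar, if_neg]
  rintro rfl
  exact hl hk

lemma inner_eq_zero_of_disjoint {Λ Λ' : Set (Fin d → ℤ)} (h : Disjoint Λ Λ') {f g : L2Torus d}
    (hf : f ∈ spectralSubspace Λ) (hg : g ∈ spectralSubspace Λ') : inner ℂ f g = 0 := by
  rw [← ((torusBasis d).hasSum_inner_mul_inner f g).tsum_eq, coe_torusBasis]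
  refine (tsum_congr fun k => ?_).trans tsum_zero
  by_cases hk : k ∈ Λ
  · rw [mem_spectralSubspace.1 hg k (Set.disjoint_left.1 h hk), mul_zero]
  · rw [← inner_conj_symm, mem_spectralSubspace.1 hf k hk, map_zero, zero_mul]

lemma orthogonal_spectralSubspace (Λ : Set (Fin d → ℤ)) :
    (spectralSubspace Λ)ᗮ = spectralSubspace Λᶜ := by
  ext f
  refine ⟨fun hf => mem_spectralSubspace.2 fun k hk => hf _ (torusChar_mem (not_not.1 hk)),
    fun hf g hg => inner_eq_zero_of_disjoint disjoint_compl_right hg hf⟩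

lemma inner_torusChar_starProjection {k : Fin d → ℤ} (Λ : Set (Fin d → ℤ)) [Decidable (k ∈ Λ)]
    (f : L2Torus d) : inner ℂ (torusChar k) ((spectralSubspace Λ).starProjection f) =
      if k ∈ Λ then inner ℂ (torusChar k) f else 0 := by
  split_ifs with hk
  · rw [← Submodule.inner_starProjection_left_eq_right,
      Submodule.starProjection_eq_self_iff.2 (torusChar_mem hk)]
  · exact mem_spectralSubspace.1 (Submodule.starProjection_apply_mem _ f) k hk

lemma starProjection_eq_self {Λ : Set (Fin d → ℤ)} {f : L2Torus d} (hf : f ∈ spectralSubspace Λ) :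
    (spectralSubspace Λ).starProjection f = f := Submodule.starProjection_eq_self_iff.2 hf

lemma starProjection_eq_zero {Λ Λ' : Set (Fin d → ℤ)} (h : Disjoint Λ Λ') {f : L2Torus d}
    (hf : f ∈ spectralSubspace Λ') : (spectralSubspace Λ).starProjection f = 0 := by
  classical
  refine ext_inner_torusChar fun k => ?_
  rw [inner_torusChar_starProjection, inner_zero_right]
  split_ifs with hk
  · exact mem_spectralSubspace.1 hf k (Set.disjoint_left.1 h hk)
  · rfl

lemma sub_starProjection_mem (Λ : Set (Fin d → ℤ)) (f : L2Torus d) :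
    f - (spectralSubspace Λ).starProjection f ∈ spectralSubspace Λᶜ := by
  rw [← orthogonal_spectralSubspace]
  exact Submodule.sub_starProjection_mem_orthogonal f

lemma starProjection_starProjection (Λ Λ' : Set (Fin d → ℤ)) (f : L2Torus d) :
    (spectralSubspace Λ).starProjection ((spectralSubspace Λ').starProjection f) =
      (spectralSubspace (Λ ∩ Λ')).starProjection f := by
  classical
  refine ext_inner_torusChar fun k => ?_
  simp only [inner_torusChar_starProjection, Set.mem_inter_iff, ite_and]

lemma projAll_eq_projH2 (d : ℕ) : projAll d = projH2 d := by
  classical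
  ext1 f
  refine ext_inner_torusChar fun k => ?_
  have key : ∀ l : List (Fin d), inner ℂ (torusChar k) ((l.map fun j => projIn j).prod f) =
      if ∀ j ∈ l, 0 ≤ k j then inner ℂ (torusChar k) f else 0 := by
    intro l
    induction l with
    | nil => simp
    | cons j l ih =>
      rw [List.map_cons, List.prod_cons, mul_apply_eq_comp, projIn,
        inner_torusChar_starProjection, ih]
      simp only [List.forall_mem_cons, ite_and, Set.mem_ofPred_eq]
  rw [projAll, List.ofFn_eq_map, key, projH2, inner_torusChar_starProjection]
  simp

/-- The pieces `(I - P_{x_j}) f` control `f ⊥ H²(𝕋^d)`. -/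
lemma norm_sq_le_sum_of_mem {f : L2Torus d} (hf : f ∈ spectralSubspace {k | ∀ j, 0 ≤ k j}ᶜ) :
    ‖f‖ ^ 2 ≤ ∑ j, ‖f - projIn j f‖ ^ 2 := by
  classical
  refine hasSum_le (fun k => ?_) (hasSum_norm_inner_torusChar_sq f)
    (hasSum_sum fun j _ => hasSum_norm_inner_torusChar_sq (f - projIn j f))
  by_cases hk : ∀ j, 0 ≤ k j
  · rw [mem_spectralSubspace.1 hf k (not_not.2 hk), norm_zero, zero_pow two_ne_zero]
    positivity
  · obtain ⟨j, hj⟩ := not_forall.1 hk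
    refine le_trans ?_ (Finset.single_le_sum
      (f := fun j => ‖inner ℂ (torusChar k) (f - projIn j f)‖ ^ 2)
      (fun _ _ => by positivity) (Finset.mem_univ j))
    rw [inner_sub_right, projIn, inner_torusChar_starProjection,
      if_neg (show k ∉ {k : Fin d → ℤ | 0 ≤ k j} from hj), sub_zero]

/-! ### Multiplication and Fourier supports -/

lemma mulL2_eq_mulOp (g : C(UnitAddTorus (Fin d), ℂ)) (f : L2Torus d) :
    mulL2 g f = mulOp (torusMeasure d) g f :=
  ((mulOp_eq_iff g f _).2 (MemLp.coeFn_toLp _).symm).symm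

lemma norm_mFourier_apply (n : Fin d → ℤ) (x : UnitAddTorus (Fin d)) :
    ‖UnitAddTorus.mFourier n x‖ = 1 := by
  simp only [UnitAddTorus.mFourier, ContinuousMap.coe_mk, norm_prod, fourier_apply,
    Circle.norm_coe, Finset.prod_const_one]

lemma star_mFourier (n : Fin d → ℤ) :
    star (UnitAddTorus.mFourier n) = UnitAddTorus.mFourier (-n) := by
  ext x
  rw [UnitAddTorus.mFourier_neg]; rfl

lemma mFourier_mul_mFourier (m n : Fin d → ℤ) :
    UnitAddTorus.mFourier m * UnitAddTorus.mFourier n = UnitAddTorus.mFourier (m + n) := by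
  ext x
  rw [UnitAddTorus.mFourier_add]; rfl

lemma mulOp_mFourier_torusChar (n k : Fin d → ℤ) :
    mulOp (torusMeasure d) (UnitAddTorus.mFourier n) (torusChar k) = torusChar (n + k) := by
  rw [torusChar_eq_toLp, mulOp_toLp, mFourier_mul_mFourier, torusChar_eq_toLp]

lemma inner_torusChar_mulOp_mFourier (n k : Fin d → ℤ) (f : L2Torus d) :
    inner ℂ (torusChar k) (mulOp (torusMeasure d) (UnitAddTorus.mFourier n) f) =
      inner ℂ (torusChar (k - n)) f := by
  rw [inner_mulOp_right, star_mFourier, mulOp_mFourier_torusChar, neg_add_eq_sub]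

lemma mulOp_mFourier_mem {Λ Λ' : Set (Fin d → ℤ)} {n : Fin d → ℤ} (h : ∀ k ∈ Λ, n + k ∈ Λ')
    {f : L2Torus d} (hf : f ∈ spectralSubspace Λ) :
    mulOp (torusMeasure d) (UnitAddTorus.mFourier n) f ∈ spectralSubspace Λ' := by
  rw [mem_spectralSubspace] at hf ⊢
  intro k hk
  rw [inner_torusChar_mulOp_mFourier]
  refine hf _ fun h' => hk ?_
  simpa using h _ h'

/-- The trigonometric polynomials with frequencies in `Λ`. -/
def polySpace (Λ : Set (Fin d → ℤ)) : Submodule ℂ C(UnitAddTorus (Fin d), ℂ) :=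
  Submodule.span ℂ (UnitAddTorus.mFourier '' Λ)

lemma mFourier_mem_polySpace {Λ : Set (Fin d → ℤ)} {n : Fin d → ℤ} (hn : n ∈ Λ) :
    UnitAddTorus.mFourier n ∈ polySpace Λ := Submodule.subset_span ⟨n, hn, rfl⟩

lemma mulOp_mem_of_mem_closure {Λ Λ' Λ'' : Set (Fin d → ℤ)} (h : ∀ n ∈ Λ, ∀ k ∈ Λ', n + k ∈ Λ'')
    {g : C(UnitAddTorus (Fin d), ℂ)} (hg : g ∈ (polySpace Λ).topologicalClosure)
    {f : L2Torus d} (hf : f ∈ spectralSubspace Λ') :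
    mulOp (torusMeasure d) g f ∈ spectralSubspace Λ'' := by
  have h1 : (polySpace Λ).topologicalClosure ≤
      (spectralSubspace Λ'').comap ((mulOp (torusMeasure d)).flip f).toLinearMap := by
    refine Submodule.topologicalClosure_minimal _ (Submodule.span_le.2 ?_)
      ((isClosed_spectralSubspace Λ'').preimage ((mulOp (torusMeasure d)).flip f).continuous)
    rintro _ ⟨n, hn, rfl⟩
    exact mulOp_mFourier_mem (h n hn) hf
  exact h1 hg

lemma toLp_mem_spectralSubspace {Λ : Set (Fin d → ℤ)} {g : C(UnitAddTorus (Fin d), ℂ)}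
    (hg : g ∈ (polySpace Λ).topologicalClosure) :
    ContinuousMap.toLp 2 (torusMeasure d) ℂ g ∈ spectralSubspace Λ := by
  have h1 := mulOp_mem_of_mem_closure (Λ' := {0}) (Λ'' := Λ) (fun n hn k hk => by
    rw [Set.mem_singleton_iff.1 hk, add_zero]; exact hn) hg (torusChar_mem (Set.mem_singleton 0))
  rwa [torusChar_eq_toLp, mulOp_toLp, UnitAddTorus.mFourier_zero, mul_one] at h1

lemma polySpace_mul {Λ Λ' Λ'' : Set (Fin d → ℤ)} (h : ∀ n ∈ Λ, ∀ k ∈ Λ', n + k ∈ Λ'')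
    {p q : C(UnitAddTorus (Fin d), ℂ)} (hp : p ∈ polySpace Λ) (hq : q ∈ polySpace Λ') :
    p * q ∈ polySpace Λ'' := by
  have h1 : polySpace Λ * polySpace Λ' ≤ polySpace Λ'' := by
    rw [polySpace, polySpace, Submodule.span_mul_span, Submodule.span_le]
    rintro _ ⟨_, ⟨n, hn, rfl⟩, _, ⟨k, hk, rfl⟩, rfl⟩
    change _ * _ ∈ _
    rw [mFourier_mul_mFourier]
    exact mFourier_mem_polySpace (h n hn k hk)
  exact h1 (Submodule.mul_mem_mul hp hq)

lemma star_mem_polySpace {Λ Λ' : Set (Fin d → ℤ)} (h : ∀ n ∈ Λ, -n ∈ Λ')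
    {p : C(UnitAddTorus (Fin d), ℂ)} (hp : p ∈ polySpace Λ) : star p ∈ polySpace Λ' := by
  induction hp using Submodule.span_induction with
  | mem x hx =>
    obtain ⟨n, hn, rfl⟩ := hx
    rw [star_mFourier]
    exact mFourier_mem_polySpace (h n hn)
  | zero => rw [star_zero]; exact zero_mem _
  | add x y _ _ hx hy => rw [star_add]; exact add_mem hx hy
  | smul c x _ hx => rw [star_smul]; exact Submodule.smul_mem _ _ hx

/-- The trigonometric polynomials with frequencies in `Λ` are dense in `spectralSubspace Λ`. -/
lemma spectralSubspace_le_closure (Λ : Set (Fin d → ℤ)) :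
    spectralSubspace Λ ≤ ((polySpace Λ).map
      (ContinuousMap.toLp (E := ℂ) 2 (torusMeasure d) ℂ).toLinearMap).topologicalClosure := by
  classical
  intro f hf
  have h1 := (torusBasis d).hasSum_repr f
  refine mem_closure_of_tendsto h1 (Filter.Eventually.of_forall fun s => Submodule.sum_mem _ ?_)
  intro k _
  rw [HilbertBasis.repr_apply_apply, coe_torusBasis]
  by_cases hk : k ∈ Λ
  · exact Submodule.smul_mem _ _ ⟨_, mFourier_mem_polySpace hk, rfl⟩
  · rw [mem_spectralSubspace.1 hf k hk, zero_smul]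
    exact zero_mem _

lemma dense_polySpace_univ (g : C(UnitAddTorus (Fin d), ℂ)) {δ : ℝ} (hδ : 0 < δ) :
    ∃ q ∈ polySpace (Set.univ : Set (Fin d → ℤ)), ‖q - g‖ < δ := by
  have h1 : g ∈ (polySpace (Set.univ : Set (Fin d → ℤ))).topologicalClosure := by
    rw [polySpace, Set.image_univ, UnitAddTorus.span_mFourier_closure_eq_top]
    trivial
  obtain ⟨q, hq, h2⟩ := Metric.mem_closure_iff.1 h1 δ hδ
  exact ⟨q, hq, by rwa [dist_comm, dist_eq_norm] at h2⟩

end Torus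

/-! ### Bounded functions as functionals on `L¹` -/

section Duality

variable {α : Type*} [MeasurableSpace α] {μ : Measure α} [IsFiniteMeasure μ]

lemma eLpNorm_top_le_of_inner_le {ψ : Lp ℂ 2 μ} {M : ℝ} (hM : 0 ≤ M)
    (h : ∀ F : Lp ℂ 2 μ, ‖inner ℂ ψ F‖ ≤ M * ∫ x, ‖F x‖ ∂μ) :
    eLpNorm ψ ∞ μ ≤ ENNReal.ofReal M := by
  have hint : Integrable (fun x => ‖ψ x‖) μ := ((Lp.memLp ψ).integrable (by norm_num)).norm
  have h1 : (fun x => ‖ψ x‖) ≤ᵐ[μ] fun _ => M := by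
    refine ae_le_of_forall_setIntegral_le hint (integrable_const M) fun s hs _ => ?_
    -- test against the phase of `ψ` on `s`
    let u : α → ℂ := s.indicator fun x => ψ x / ‖ψ x‖
    have hu1 : ∀ x, ‖u x‖ ≤ s.indicator 1 x := fun x => by
      by_cases hx : x ∈ s
      · simp only [u, Set.indicator_of_mem hx, norm_div, Complex.norm_real, norm_norm]
        exact div_self_le_one _
      · simp [u, Set.indicator_of_notMem hx]
    have hu1' : ∀ x, ‖u x‖ ≤ 1 := fun x =>
      (hu1 x).trans (Set.indicator_apply_le' (fun _ => le_rfl) fun _ => zero_le_one)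
    have hum : AEStronglyMeasurable u μ :=
      ((Lp.stronglyMeasurable ψ).measurable.div
        (Complex.measurable_ofReal.comp (Lp.stronglyMeasurable ψ).measurable.norm)
          |>.indicator hs).aestronglyMeasurable
    have huL : MemLp u 2 μ := MemLp.of_bound hum 1 (Filter.Eventually.of_forall hu1')
    have h2 := h huL.toLp
    have h3 : inner ℂ ψ huL.toLp = ((∫ x in s, ‖ψ x‖ ∂μ : ℝ) : ℂ) := by
      rw [L2.inner_def, ← integral_indicator hs, ← integral_complex_ofReal]
      refine integral_congr_ae ?_
      filter_upwards [huL.coeFn_toLp] with x hx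
      rw [hx]
      by_cases hxs : x ∈ s
      · simp only [u, Set.indicator_of_mem hxs, RCLike.inner_apply]
        by_cases h0 : ψ x = 0
        · simp [h0]
        · have h0' : (‖ψ x‖ : ℂ) ≠ 0 := by simpa using h0
          rw [div_mul_eq_mul_div, Complex.mul_conj, Complex.normSq_eq_norm_sq]
          push_cast
          field_simp
      · simp [u, Set.indicator_of_notMem hxs]
    rw [h3, Complex.norm_real, Real.norm_of_nonneg (integral_nonneg fun _ => norm_nonneg _)] at h2
    refine h2.trans ?_
    rw [setIntegral_const, smul_eq_mul, mul_comm]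
    gcongr
    calc ∫ x, ‖huL.toLp u x‖ ∂μ ≤ ∫ x, s.indicator 1 x ∂μ := by
          refine integral_mono_ae ((Lp.memLp _).integrable (by norm_num)).norm
            ((integrable_const (1 : ℝ)).indicator hs) ?_
          filter_upwards [huL.coeFn_toLp] with x hx
          rw [hx]
          exact hu1 x
      _ = μ.real s := integral_indicator_one hs
  rw [eLpNorm_exponent_top]
  refine essSup_le_of_ae_le _ ?_
  filter_upwards [h1] with x hx
  rw [← ofReal_norm]
  exact ENNReal.ofReal_le_ofReal hx

variable (μ) in
/-- The inclusion of `L²(μ)` in `L¹(μ)`. -/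
def inclL1 : Lp ℂ 2 μ →L[ℂ] Lp ℂ 1 μ :=
  (ContinuousLinearMap.mul ℂ ℂ).holderL μ 2 2 1 (MemLp.toLp (fun _ => 1) (memLp_const 1))

lemma coeFn_inclL1 (f : Lp ℂ 2 μ) : inclL1 μ f =ᵐ[μ] f := by
  have h1 := (ContinuousLinearMap.mul ℂ ℂ).coeFn_holder (r := 1)
    (MemLp.toLp (fun _ => (1 : ℂ)) (memLp_const (μ := μ) (p := 2) 1)) f
  refine h1.trans ?_
  filter_upwards [MemLp.coeFn_toLp (memLp_const (μ := μ) (p := 2) (1 : ℂ))] with x hx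
  rw [ContinuousLinearMap.mul_apply', hx, one_mul]

lemma norm_inclL1 (f : Lp ℂ 2 μ) : ‖inclL1 μ f‖ = ∫ x, ‖f x‖ ∂μ := by
  rw [L1.norm_eq_integral_norm]
  refine integral_congr_ae ?_
  filter_upwards [coeFn_inclL1 f] with x hx
  rw [hx]

lemma inclL1_injective : Function.Injective (inclL1 μ) := fun f g h =>
  Lp.ext ((coeFn_inclL1 f).symm.trans (h ▸ coeFn_inclL1 g))

/-- A functional on a subspace of `L²(μ)` that is bounded by `M` in the norm of `L¹(μ)` is
represented by a function bounded by `M`. -/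
lemma exists_eLpNorm_top_le_inner_eq (W : Submodule ℂ (Lp ℂ 2 μ)) {φ : Lp ℂ 2 μ} {M : ℝ}
    (hM : 0 ≤ M) (h : ∀ F ∈ W, ‖inner ℂ φ F‖ ≤ M * ∫ x, ‖F x‖ ∂μ) :
    ∃ ψ : Lp ℂ 2 μ, eLpNorm ψ ∞ μ ≤ ENNReal.ofReal M ∧ ∀ F ∈ W, inner ℂ ψ F = inner ℂ φ F := by
  let e := Submodule.equivMapOfInjective (inclL1 μ).toLinearMap inclL1_injective W
  have he : ∀ y, inclL1 μ (e.symm y) = y := fun y =>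
    congrArg Subtype.val (e.apply_symm_apply y)
  let ℓ : W.map (inclL1 μ).toLinearMap →L[ℂ] ℂ :=
    LinearMap.mkContinuous ((innerSL ℂ φ).toLinearMap ∘ₗ W.subtype ∘ₗ e.symm.toLinearMap) M
      fun y => by
        have h1 := h (e.symm y) (e.symm y).2
        rwa [← norm_inclL1, he] at h1
  obtain ⟨L, hL, hLn⟩ := exists_extension_norm_eq _ ℓ
  have hLM : ‖L‖ ≤ M := hLn ▸ LinearMap.mkContinuous_norm_le _ hM _
  refine ⟨(InnerProductSpace.toDual ℂ (Lp ℂ 2 μ)).symm (L.comp (inclL1 μ)), ?_, fun F hF => ?_⟩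
  · refine eLpNorm_top_le_of_inner_le hM fun F => ?_
    rw [InnerProductSpace.toDual_symm_apply, ← norm_inclL1]
    exact L.le_of_opNorm_le hLM _
  · rw [InnerProductSpace.toDual_symm_apply]
    have h1 := hL (e ⟨F, hF⟩)
    have h2 : ℓ (e ⟨F, hF⟩) = inner ℂ φ F := by
      change inner ℂ φ ((e.symm (e ⟨F, hF⟩) : W) : Lp ℂ 2 μ) = _
      rw [e.symm_apply_apply]
    exact h1.trans h2

end Duality

/-! ### Nehari's theorem in one of the variables -/

section Nehari

variable {d : ℕ}

lemma sub_projIn_eq_iff {φ ψ : L2Torus d} {j : Fin d} :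
    φ - projIn j φ = ψ - projIn j ψ ↔ φ - ψ ∈ hardyIn j := by
  rw [← Submodule.starProjection_eq_self_iff, map_sub, ← projIn, sub_eq_sub_iff_sub_eq_sub,
    eq_comm]

lemma projIn_mem (j : Fin d) (f : L2Torus d) : projIn j f ∈ hardyIn j :=
  Submodule.starProjection_apply_mem _ f

lemma exp_mem_closure_polySpace {Λ : Set (Fin d → ℤ)} (h0 : 0 ∈ Λ)
    (hadd : ∀ n ∈ Λ, ∀ k ∈ Λ, n + k ∈ Λ) {a : C(UnitAddTorus (Fin d), ℂ)} (ha : a ∈ polySpace Λ) :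
    NormedSpace.exp a ∈ (polySpace Λ).topologicalClosure := by
  have hpow : ∀ n : ℕ, a ^ n ∈ polySpace Λ := by
    intro n
    induction n with
    | zero => rw [pow_zero, ← UnitAddTorus.mFourier_zero]; exact mFourier_mem_polySpace h0
    | succ n ih => rw [pow_succ]; exact polySpace_mul hadd ih ha
  exact mem_closure_of_tendsto (NormedSpace.exp_series_hasSum_exp' (𝕂 := ℂ) a)
    (Filter.Eventually.of_forall fun s => Submodule.sum_mem _ fun n _ =>
      Submodule.smul_mem _ _ (hpow n))

lemma exp_continuousMap_apply {α : Type*} [TopologicalSpace α] [CompactSpace α] (a : C(α, ℂ))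
    (x : α) : NormedSpace.exp a x = Complex.exp (a x) := by
  rw [Complex.exp_eq_exp_ℂ]
  exact NormedSpace.map_exp (ContinuousMap.evalAlgHom ℂ ℂ x) (continuous_eval_const x) a

lemma norm_toLp_sq_le {g : C(UnitAddTorus (Fin d), ℂ)} {ρ : C(UnitAddTorus (Fin d), ℝ)}
    (h : ∀ x, ‖g x‖ ^ 2 ≤ ρ x) :
    ‖ContinuousMap.toLp 2 (torusMeasure d) ℂ g‖ ^ 2 ≤ ∫ x, ρ x ∂torusMeasure d := by
  have h1 : ‖ContinuousMap.toLp 2 (torusMeasure d) ℂ g‖ ^ 2 = ∫ x, ‖g x‖ ^ 2 ∂torusMeasure d := by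
    have h2 := inner_self_eq_norm_sq_to_K (𝕜 := ℂ) (ContinuousMap.toLp 2 (torusMeasure d) ℂ g)
    rw [ContinuousMap.inner_toLp] at h2
    have h3 : ∀ x, g x * conj (g x) = ((‖g x‖ ^ 2 : ℝ) : ℂ) := fun x => by
      rw [Complex.mul_conj, Complex.normSq_eq_norm_sq]
    simp_rw [h3] at h2
    rw [integral_complex_ofReal] at h2
    rw [← RCLike.ofReal_pow] at h2
    exact (Complex.ofReal_injective h2).symm
  rw [h1]
  exact integral_mono ((g.continuous.norm.pow 2).integrable_of_hasCompactSupport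
    (HasCompactSupport.of_compactSpace _))
    (ρ.continuous.integrable_of_hasCompactSupport (HasCompactSupport.of_compactSpace _)) h

/-- A trigonometric polynomial `F` is a product `conj A * (B * F)` with `A` analytic in `x_j`, `B`
antianalytic in `x_j`, and both `|A|²` and `|B F|²` at most `exp η * (|F| + η)`. Here `A` is
`exp a`, for a polynomial `a` analytic in `x_j` whose real part is uniformly close to
`log (|F| + η) / 2`, and `B` is `conj A⁻¹`. -/
lemma exists_factorization (j : Fin d) (F : C(UnitAddTorus (Fin d), ℂ)) {η : ℝ} (hη : 0 < η) :
    ∃ A ∈ (polySpace {k : Fin d → ℤ | 0 ≤ k j}).topologicalClosure,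
      ∃ B ∈ (polySpace {k : Fin d → ℤ | k j ≤ 0}).topologicalClosure,
        star A * (B * F) = F ∧ (∀ x, ‖A x‖ ^ 2 ≤ Real.exp η * (‖F x‖ + η)) ∧
          ∀ x, ‖(B * F) x‖ ^ 2 ≤ Real.exp η * (‖F x‖ + η) := by
  have hpos : ∀ x, 0 < ‖F x‖ + η := fun x => by positivity
  let l : C(UnitAddTorus (Fin d), ℂ) := ⟨fun x => ((Real.log (‖F x‖ + η) : ℝ) : ℂ),
    Complex.continuous_ofReal.comp (Continuous.log (by fun_prop) fun x => (hpos x).ne')⟩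
  obtain ⟨q, hq, hql⟩ := dense_polySpace_univ l hη
  have hq' : q ∈ polySpace {k : Fin d → ℤ | 0 ≤ k j} ⊔ polySpace {k : Fin d → ℤ | 0 ≤ k j}ᶜ := by
    rw [polySpace, polySpace, ← Submodule.span_union, ← Set.image_union, Set.union_compl_self]
    exact hq
  obtain ⟨q₁, hq₁, q₂, hq₂, rfl⟩ := Submodule.mem_sup.1 hq'
  -- `a` is analytic in `x_j`, and its real part is that of `q / 2`
  let a : C(UnitAddTorus (Fin d), ℂ) := (1 / 2 : ℂ) • (q₁ + star q₂)
  have ha : a ∈ polySpace {k : Fin d → ℤ | 0 ≤ k j} := by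
    refine Submodule.smul_mem _ _ (add_mem hq₁ (star_mem_polySpace (fun n hn => ?_) hq₂))
    simp only [Set.mem_compl_iff, Set.mem_ofPred_eq, not_le, Pi.neg_apply] at hn ⊢
    omega
  have hare : ∀ x, 2 * (a x).re = ((q₁ + q₂) x).re := fun x => by
    simp [a]
  have hq_re : ∀ x, |((q₁ + q₂) x).re - Real.log (‖F x‖ + η)| ≤ η := fun x => by
    have h1 := (ContinuousMap.norm_coe_le_norm (q₁ + q₂ - l) x).trans hql.le
    have h2 := (Complex.abs_re_le_norm _).trans h1
    rwa [ContinuousMap.sub_apply, Complex.sub_re] at h2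
  have hAx : ∀ x, NormedSpace.exp a x = Complex.exp (a x) := exp_continuousMap_apply a
  have hBx : ∀ x, NormedSpace.exp (-star a) x = Complex.exp (-conj (a x)) :=
    exp_continuousMap_apply (-star a)
  refine ⟨NormedSpace.exp a, exp_mem_closure_polySpace ?_ (fun n hn k hk => ?_) ha,
    NormedSpace.exp (-star a), exp_mem_closure_polySpace ?_ (fun n hn k hk => ?_)
      (neg_mem (star_mem_polySpace (fun n hn => ?_) ha)), ?_, fun x => ?_, fun x => ?_⟩
  · simp
  · simp only [Set.mem_ofPred_eq, Pi.add_apply] at hn hk ⊢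
    omega
  · simp
  · simp only [Set.mem_ofPred_eq, Pi.add_apply] at hn hk ⊢
    omega
  · simp only [Set.mem_ofPred_eq, Pi.neg_apply] at hn ⊢
    omega
  · ext x
    rw [ContinuousMap.mul_apply, ContinuousMap.mul_apply, ContinuousMap.star_apply, hAx, hBx,
      RCLike.star_def, ← Complex.exp_conj, ← mul_assoc, ← Complex.exp_add, add_neg_cancel,
      Complex.exp_zero, one_mul]
  · have h1 := (abs_le.1 (hq_re x)).2
    rw [hAx, Complex.norm_exp, ← Real.exp_nat_mul, Nat.cast_ofNat, hare]
    calc Real.exp ((q₁ + q₂) x).re ≤ Real.exp (η + Real.log (‖F x‖ + η)) :=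
          Real.exp_le_exp.2 (by linarith)
      _ = _ := by rw [Real.exp_add, Real.exp_log (hpos x)]
  · have h1 := (abs_le.1 (hq_re x)).1
    rw [ContinuousMap.mul_apply, norm_mul, mul_pow, hBx, Complex.norm_exp, ← Real.exp_nat_mul,
      Nat.cast_ofNat, Complex.neg_re, Complex.conj_re, mul_neg, hare]
    calc Real.exp (-((q₁ + q₂) x).re) * ‖F x‖ ^ 2
        ≤ Real.exp (η - Real.log (‖F x‖ + η)) * (‖F x‖ + η) ^ 2 := by
          gcongr
          · linarith
          · linarith
      _ = _ := by
          have := (hpos x).ne'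
          rw [Real.exp_sub, Real.exp_log (hpos x)]
          field_simp

/-- If `‖(I - P_{x_j}) (φ p)‖ ≤ M ‖p‖` for all trigonometric polynomials `p` that are analytic in
`x_j`, then `φ` is bounded by `M` in the norm of `L¹`, as a functional on the trigonometric
polynomials with strictly negative frequencies in `x_j`. -/
lemma norm_inner_le_of_norm_sub_projIn_le {φ : L2Torus d} {j : Fin d} {M : ℝ} (hM : 0 ≤ M)
    (h : ∀ p ∈ polySpace {k : Fin d → ℤ | 0 ≤ k j},
      ‖mulOp (torusMeasure d) p φ - projIn j (mulOp (torusMeasure d) p φ)‖ ≤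
        M * ‖ContinuousMap.toLp 2 (torusMeasure d) ℂ p‖)
    {F : C(UnitAddTorus (Fin d), ℂ)} (hF : F ∈ polySpace {k : Fin d → ℤ | 0 ≤ k j}ᶜ) :
    ‖inner ℂ φ (ContinuousMap.toLp 2 (torusMeasure d) ℂ F)‖ ≤
      M * ∫ x, ‖F x‖ ∂torusMeasure d := by
  have hcl : ∀ p ∈ (polySpace {k : Fin d → ℤ | 0 ≤ k j}).topologicalClosure,
      ‖mulOp (torusMeasure d) p φ - projIn j (mulOp (torusMeasure d) p φ)‖ ≤
        M * ‖ContinuousMap.toLp 2 (torusMeasure d) ℂ p‖ := by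
    intro p hp
    have hcont : Continuous fun p => mulOp (torusMeasure d) p φ :=
      ((mulOp (torusMeasure d)).flip φ).continuous
    have hclosed : IsClosed {p | ‖mulOp (torusMeasure d) p φ -
        projIn j (mulOp (torusMeasure d) p φ)‖ ≤
        M * ‖ContinuousMap.toLp (E := ℂ) 2 (torusMeasure d) ℂ p‖} :=
      isClosed_le (hcont.sub ((projIn j).continuous.comp hcont)).norm
        (continuous_const.mul (ContinuousMap.toLp (E := ℂ) 2 (torusMeasure d) ℂ).continuous.norm)
    exact closure_minimal (fun p hp => h p hp) hclosed hp
  have main : ∀ η : ℝ, 0 < η → ‖inner ℂ φ (ContinuousMap.toLp 2 (torusMeasure d) ℂ F)‖ ≤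
      M * (Real.exp η * ((∫ x, ‖F x‖ ∂torusMeasure d) + η)) := by
    intro η hη
    obtain ⟨A, hA, B, hB, hAB, hA2, hg2⟩ := exists_factorization j F hη
    let ρ : C(UnitAddTorus (Fin d), ℝ) := ⟨fun x => Real.exp η * (‖F x‖ + η), by fun_prop⟩
    have hgmem : ContinuousMap.toLp 2 (torusMeasure d) ℂ (B * F) ∈
        spectralSubspace {k : Fin d → ℤ | 0 ≤ k j}ᶜ := by
      rw [← mulOp_toLp]
      refine mulOp_mem_of_mem_closure (fun n hn k hk => ?_) hB
        (toLp_mem_spectralSubspace (Submodule.le_topologicalClosure _ hF))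
      simp only [Set.mem_compl_iff, Set.mem_ofPred_eq, not_le, Pi.add_apply] at hn hk ⊢
      omega
    have hρ : ∫ x, ρ x ∂torusMeasure d =
        Real.exp η * ((∫ x, ‖F x‖ ∂torusMeasure d) + η) := by
      change ∫ x, Real.exp η * (‖F x‖ + η) ∂torusMeasure d = _
      rw [integral_const_mul, integral_add (F.continuous.norm.integrable_of_hasCompactSupport
        (HasCompactSupport.of_compactSpace _)) (integrable_const _)]
      simp
    have hA3 := norm_toLp_sq_le (ρ := ρ) hA2
    have hg3 := norm_toLp_sq_le (ρ := ρ) hg2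
    set v := mulOp (torusMeasure d) A φ with hv
    have h4 : inner ℂ φ (ContinuousMap.toLp 2 (torusMeasure d) ℂ F) =
        inner ℂ (v - projIn j v) (ContinuousMap.toLp 2 (torusMeasure d) ℂ (B * F)) := by
      rw [inner_sub_left, inner_eq_zero_of_disjoint disjoint_compl_right
        (projIn_mem j v) hgmem, sub_zero, hv, inner_mulOp_left,
        mulOp_toLp, hAB]
    rw [h4, ← hρ]
    refine (norm_inner_le_norm _ _).trans ?_
    refine (mul_le_mul_of_nonneg_right (hcl A hA) (norm_nonneg _)).trans ?_
    rw [mul_assoc]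
    refine mul_le_mul_of_nonneg_left ?_ hM
    -- `‖A‖ ‖B F‖ ≤ (‖A‖² + ‖B F‖²) / 2`
    nlinarith [sq_nonneg (‖ContinuousMap.toLp 2 (torusMeasure d) ℂ A‖ -
      ‖ContinuousMap.toLp 2 (torusMeasure d) ℂ (B * F)‖)]
  have hlim : Filter.Tendsto (fun η : ℝ => M * (Real.exp η *
      ((∫ x, ‖F x‖ ∂torusMeasure d) + η))) (nhdsWithin 0 (Set.Ioi 0))
      (nhds (M * ∫ x, ‖F x‖ ∂torusMeasure d)) := by
    have h1 : Continuous fun η : ℝ => M * (Real.exp η * ((∫ x, ‖F x‖ ∂torusMeasure d) + η)) := by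
      fun_prop
    have h2 := h1.tendsto 0
    simp only [Real.exp_zero, one_mul, add_zero] at h2
    exact h2.mono_left nhdsWithin_le_nhds
  refine ge_of_tendsto hlim ?_
  filter_upwards [self_mem_nhdsWithin] with η hη
  exact main η hη

/-- Nehari's theorem in the variable `x_j`, the other variables being parameters. -/
lemma exists_bounded_of_norm_sub_projIn_le {φ : L2Torus d} {j : Fin d} {M : ℝ} (hM : 0 ≤ M)
    (h : ∀ p ∈ polySpace {k : Fin d → ℤ | 0 ≤ k j},
      ‖mulOp (torusMeasure d) p φ - projIn j (mulOp (torusMeasure d) p φ)‖ ≤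
        M * ‖ContinuousMap.toLp 2 (torusMeasure d) ℂ p‖) :
    ∃ ψ : L2Torus d, eLpNorm ψ ∞ (torusMeasure d) ≤ ENNReal.ofReal M ∧
      φ - projIn j φ = ψ - projIn j ψ := by
  obtain ⟨ψ, hψ, h1⟩ := exists_eLpNorm_top_le_inner_eq
    ((polySpace {k : Fin d → ℤ | 0 ≤ k j}ᶜ).map
      (ContinuousMap.toLp (E := ℂ) 2 (torusMeasure d) ℂ).toLinearMap) (φ := φ) hM (by
    rintro _ ⟨F, hF, rfl⟩
    refine (norm_inner_le_of_norm_sub_projIn_le hM h hF).trans_eq ?_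
    congr 1
    refine integral_congr_ae ?_
    filter_upwards [ContinuousMap.coeFn_toLp (p := 2) (𝕜 := ℂ) (torusMeasure d) F] with x hx
    exact congrArg norm hx.symm)
  refine ⟨ψ, hψ, sub_projIn_eq_iff.2 (mem_spectralSubspace.2 fun k hk => ?_)⟩
  have h2 := h1 (torusChar k) ⟨_, mFourier_mem_polySpace hk, rfl⟩
  rw [inner_sub_right, sub_eq_zero, ← inner_conj_symm, ← h2, inner_conj_symm]

end Nehari

/-! ### Hankel operators -/

section Hankel

variable {d : ℕ}

lemma projH2_mem (f : L2Torus d) : projH2 d f ∈ hardy d := Submodule.starProjection_apply_mem _ f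

lemma sub_projH2_mem (f : L2Torus d) : f - projH2 d f ∈ (hardy d)ᗮ :=
  Submodule.sub_starProjection_mem_orthogonal f

lemma hardy_le_hardyIn (j : Fin d) : hardy d ≤ hardyIn j := spectralSubspace_mono fun _ hk => hk j

lemma mem_hardy_iff {f : L2Torus d} : f ∈ hardy d ↔ ∀ j, f ∈ hardyIn j := by
  refine ⟨fun h j => hardy_le_hardyIn j h, fun h => mem_spectralSubspace.2 fun k hk => ?_⟩
  obtain ⟨j, hj⟩ := not_forall.1 hk
  exact mem_spectralSubspace.1 (h j) k hj

lemma norm_sub_projIn_le (j : Fin d) (f : L2Torus d) : ‖f - projIn j f‖ ≤ ‖f‖ := by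
  rw [projIn, ← Submodule.starProjection_orthogonal_val]
  exact Submodule.norm_starProjection_apply_le _ f

lemma sub_projIn_sub_projH2 (j : Fin d) (f : L2Torus d) :
    (f - projH2 d f) - projIn j (f - projH2 d f) = f - projIn j f := by
  rw [sub_projIn_eq_iff, sub_sub_cancel_left]
  exact neg_mem (hardy_le_hardyIn j (projH2_mem f))

/-- If `φ` has a decomposition bounded by `M`, then the Hankel operator with symbol `φ` is bounded
by `√d * M`: its range is controlled by the `d` pieces `(I - P_{x_j}) (p φ)`, which coincide with
`(I - P_{x_j}) (p φ_j)`. -/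
lemma norm_sub_projH2_le {φ φ₀ : L2Torus d} {ϕ : Fin d → L2Torus d} (hφ : IsBMOrDecomp φ φ₀ ϕ)
    {M : ℝ} (hM : 0 ≤ M) (hϕ : ∀ j, eLpNorm (ϕ j) ∞ (torusMeasure d) ≤ ENNReal.ofReal M)
    {p : C(UnitAddTorus (Fin d), ℂ)}
    (hp : ∀ j, ∀ f ∈ hardyIn j, mulOp (torusMeasure d) p f ∈ hardyIn j) :
    ‖mulOp (torusMeasure d) p φ - projH2 d (mulOp (torusMeasure d) p φ)‖ ≤
      √d * M * ‖ContinuousMap.toLp 2 (torusMeasure d) ℂ p‖ := by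
  set v := mulOp (torusMeasure d) p φ
  have h1 : ‖v - projH2 d v‖ ^ 2 ≤ ∑ j, ‖v - projIn j v‖ ^ 2 := by
    refine (norm_sq_le_sum_of_mem ?_).trans_eq
      (Finset.sum_congr rfl fun j _ => by rw [sub_projIn_sub_projH2])
    rw [← orthogonal_spectralSubspace]
    exact sub_projH2_mem v
  have h2 : ∀ j, ‖v - projIn j v‖ ≤ M * ‖ContinuousMap.toLp 2 (torusMeasure d) ℂ p‖ := fun j => by
    have h3 : v - projIn j v = mulOp (torusMeasure d) p (ϕ j) -
        projIn j (mulOp (torusMeasure d) p (ϕ j)) := by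
      rw [sub_projIn_eq_iff, ← map_sub]
      exact hp j _ (sub_projIn_eq_iff.1 (hφ.antianalytic j))
    rw [h3]
    exact (norm_sub_projIn_le j _).trans (norm_mulOp_le_of_eLpNorm_le p hM (hϕ j))
  refine le_of_sq_le_sq ?_ (by positivity)
  calc ‖v - projH2 d v‖ ^ 2 ≤ ∑ j, ‖v - projIn j v‖ ^ 2 := h1
    _ ≤ ∑ _j : Fin d, (M * ‖ContinuousMap.toLp 2 (torusMeasure d) ℂ p‖) ^ 2 :=
      Finset.sum_le_sum fun j _ => pow_le_pow_left₀ (norm_nonneg _) (h2 j) 2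
    _ = _ := by
      rw [Finset.sum_const, Finset.card_univ, Fintype.card_fin, nsmul_eq_mul, mul_pow, mul_pow,
        mul_pow, Real.sq_sqrt (Nat.cast_nonneg d)]
      ring

lemma toLp_mem_hardy {p : C(UnitAddTorus (Fin d), ℂ)} (hp : p ∈ analyticPoly d) :
    ContinuousMap.toLp 2 (torusMeasure d) ℂ p ∈ hardy d :=
  toLp_mem_spectralSubspace (Submodule.le_topologicalClosure _ hp)

lemma mulOp_mem_hardyIn {p : C(UnitAddTorus (Fin d), ℂ)} (hp : p ∈ analyticPoly d) (j : Fin d)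
    {f : L2Torus d} (hf : f ∈ hardyIn j) : mulOp (torusMeasure d) p f ∈ hardyIn j :=
  mulOp_mem_of_mem_closure (Λ := {k | ∀ j, 0 ≤ k j}) (Λ'' := {k | 0 ≤ k j})
    (fun n hn k hk => show 0 ≤ n j + k j from add_nonneg (hn j) hk)
    (Submodule.le_topologicalClosure _ hp) hf

/-- The analytic polynomials as elements of the Hardy space. -/
def polyToHardy (d : ℕ) : analyticPoly d →ₗ[ℂ] hardy d :=
  ((ContinuousMap.toLp (E := ℂ) 2 (torusMeasure d) ℂ).toLinearMap ∘ₗ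
    (analyticPoly d).subtype).codRestrict _ fun p => toLp_mem_hardy p.2

lemma mem_closure_range_polyToHardy {f : L2Torus d} (hf : f ∈ hardy d) :
    f ∈ closure (Subtype.val '' Set.range (polyToHardy d)) := by
  have h1 : (Subtype.val '' Set.range (polyToHardy d) : Set (L2Torus d)) =
      ((polySpace {k : Fin d → ℤ | ∀ j, 0 ≤ k j}).map
        (ContinuousMap.toLp (E := ℂ) 2 (torusMeasure d) ℂ).toLinearMap : Set (L2Torus d)) := by
    ext g
    constructor
    · rintro ⟨_, ⟨p, rfl⟩, rfl⟩
      exact ⟨p, p.2, rfl⟩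
    · rintro ⟨p, hp, rfl⟩
      exact ⟨_, ⟨⟨p, hp⟩, rfl⟩, rfl⟩
  rw [h1]
  exact spectralSubspace_le_closure _ hf

lemma denseRange_polyToHardy (d : ℕ) : DenseRange (polyToHardy d) := fun f =>
  closure_subtype.2 (mem_closure_range_polyToHardy f.2)

lemma eq_polyToHardy {p : C(UnitAddTorus (Fin d), ℂ)} (hp : p ∈ analyticPoly d) {f : hardy d}
    (hf : (f : UnitAddTorus (Fin d) → ℂ) =ᵐ[torusMeasure d] p) : f = polyToHardy d ⟨p, hp⟩ :=
  Subtype.ext (Lp.ext (hf.trans (ContinuousMap.coeFn_toLp _ p).symm))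

lemma IsHankelWithSymbol.apply_polyToHardy {φ : L2Torus d} {Γ : hardy d →L[ℂ] (hardy d)ᗮ}
    (hΓ : IsHankelWithSymbol φ Γ) (p : analyticPoly d) :
    (Γ (polyToHardy d p) : L2Torus d) =
      mulOp (torusMeasure d) p φ - projH2 d (mulOp (torusMeasure d) p φ) := by
  rw [← mulL2_eq_mulOp]
  exact hΓ p p.2 _ (ContinuousMap.coeFn_toLp _ _)

lemma IsHankelWithSymbol.unique {φ : L2Torus d} {Γ Γ' : hardy d →L[ℂ] (hardy d)ᗮ}
    (hΓ : IsHankelWithSymbol φ Γ) (hΓ' : IsHankelWithSymbol φ Γ') : Γ = Γ' := by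
  refine ContinuousLinearMap.coeFn_injective
    ((denseRange_polyToHardy d).equalizer Γ.continuous Γ'.continuous (funext fun p => ?_))
  exact Subtype.ext ((hΓ.apply_polyToHardy p).trans (hΓ'.apply_polyToHardy p).symm)

/-- The Hankel operator with symbol `φ` on the analytic polynomials. -/
def hankelPoly (φ : L2Torus d) : analyticPoly d →ₗ[ℂ] (hardy d)ᗮ :=
  ((ContinuousLinearMap.id ℂ _ - projH2 d).toLinearMap ∘ₗ
    ((mulOp (torusMeasure d)).flip φ).toLinearMap ∘ₗ (analyticPoly d).subtype).codRestrict _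
    fun _ => sub_projH2_mem _

lemma coe_hankelPoly (φ : L2Torus d) (p : analyticPoly d) :
    (hankelPoly φ p : L2Torus d) = mulOp (torusMeasure d) (p : C(_, ℂ)) φ -
      projH2 d (mulOp (torusMeasure d) (p : C(_, ℂ)) φ) := rfl

lemma exists_extension_of_dense {E H G : Type*} [AddCommMonoid E] [Module ℂ E]
    [NormedAddCommGroup H] [NormedSpace ℂ H] [NormedAddCommGroup G] [NormedSpace ℂ G]
    [CompleteSpace G] {K : Submodule ℂ H} (T : E →ₗ[ℂ] G) (e : E →ₗ[ℂ] K)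
    (he : ∀ f ∈ K, f ∈ closure (Subtype.val '' Set.range e)) {C : ℝ}
    (h : ∀ p, ‖T p‖ ≤ C * ‖(e p : H)‖) : ∃ Γ : K →L[ℂ] G, ∀ p, Γ (e p) = T p :=
  letI : AddCommGroup E := Module.addCommMonoidToAddCommGroup ℂ
  ⟨T.extendOfNorm e, LinearMap.extendOfNorm_eq
    (fun f => closure_subtype.2 (he f f.2)) ⟨C, h⟩⟩

lemma exists_isHankelWithSymbol {φ : L2Torus d} (hφ : MemBMOr φ) :
    ∃ Γ : hardy d →L[ℂ] (hardy d)ᗮ, IsHankelWithSymbol φ Γ := by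
  obtain ⟨φ₀, ϕ, h⟩ := hφ
  let M : ℝ := ∑ j, (eLpNorm (ϕ j) ∞ (torusMeasure d)).toReal
  have hM : ∀ j, eLpNorm (ϕ j) ∞ (torusMeasure d) ≤ ENNReal.ofReal M := fun j => by
    rw [← ENNReal.ofReal_toReal (h.memLp j).2.ne]
    exact ENNReal.ofReal_le_ofReal (Finset.single_le_sum
      (f := fun j => (eLpNorm (ϕ j) ∞ (torusMeasure d)).toReal)
      (fun _ _ => ENNReal.toReal_nonneg) (Finset.mem_univ j))
  have hM0 : 0 ≤ M := Finset.sum_nonneg fun _ _ => ENNReal.toReal_nonneg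
  have hT : ∀ p : analyticPoly d, ‖hankelPoly φ p‖ ≤ √d * M * ‖(polyToHardy d p : L2Torus d)‖ :=
    fun p => norm_sub_projH2_le h hM0 hM fun j f hf => mulOp_mem_hardyIn p.2 j hf
  obtain ⟨Γ, hΓ⟩ := exists_extension_of_dense (E := analyticPoly d) (H := L2Torus d)
    (G := (hardy d)ᗮ) (hankelPoly φ) (polyToHardy d) (fun _ => mem_closure_range_polyToHardy) hT
  refine ⟨Γ, fun p hp f hf => ?_⟩
  rw [eq_polyToHardy hp hf, hΓ, coe_hankelPoly, mulL2_eq_mulOp]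

lemma inner_torusChar_mulOp (g : C(UnitAddTorus (Fin d), ℂ)) (φ : L2Torus d) (k : Fin d → ℤ) :
    inner ℂ (torusChar k) (mulOp (torusMeasure d) g φ) =
      inner ℂ (mulOp (torusMeasure d) (UnitAddTorus.mFourier k) (star φ))
        (ContinuousMap.toLp 2 (torusMeasure d) ℂ g) := by
  rw [L2.inner_def, L2.inner_def, torusChar_eq_toLp]
  refine integral_congr_ae ?_
  filter_upwards [coeFn_mulOp g φ, coeFn_mulOp (UnitAddTorus.mFourier k) (star φ), Lp.coeFn_star φ,
    ContinuousMap.coeFn_toLp (p := 2) (𝕜 := ℂ) (torusMeasure d) g,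
    ContinuousMap.coeFn_toLp (p := 2) (𝕜 := ℂ) (torusMeasure d) (UnitAddTorus.mFourier k)]
    with x h1 h2 h3 h4 h5
  rw [h1, h2, h3, h4, h5]
  simp only [RCLike.inner_apply, Pi.star_apply, RCLike.star_def, map_mul, Complex.conj_conj]
  ring

/-- The formula for the Hankel operator extends from the analytic polynomials to the continuous
functions in `H²(𝕋^d)`: each Fourier coefficient of `g φ` is continuous in the `L²`-norm of `g`. -/
lemma IsHankelWithSymbol.apply_of_coe_eq {φ : L2Torus d} {Γ : hardy d →L[ℂ] (hardy d)ᗮ}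
    (hΓ : IsHankelWithSymbol φ Γ) {g : C(UnitAddTorus (Fin d), ℂ)} {f : hardy d}
    (hf : (f : L2Torus d) = ContinuousMap.toLp 2 (torusMeasure d) ℂ g) :
    (Γ f : L2Torus d) =
      mulOp (torusMeasure d) g φ - projH2 d (mulOp (torusMeasure d) g φ) := by
  have horth : ∀ k : Fin d → ℤ, ∀ v ∈ (hardy d)ᗮ, (∀ j, 0 ≤ k j) → inner ℂ (torusChar k) v = 0 :=
    fun k v hv hk => hv _ (torusChar_mem hk)
  refine ext_inner_torusChar fun k => ?_
  by_cases hk : ∀ j, 0 ≤ k j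
  · rw [horth k _ (Γ f).2 hk, horth k _ (sub_projH2_mem _) hk]
  · have hP : ∀ v : L2Torus d, inner ℂ (torusChar k) (v - projH2 d v) =
        inner ℂ (torusChar k) v := fun v => by
      rw [inner_sub_right, mem_spectralSubspace.1 (projH2_mem v) k hk, sub_zero]
    have h1 : (fun f : hardy d => inner ℂ (torusChar k) (Γ f : L2Torus d)) = fun f : hardy d =>
        inner ℂ (mulOp (torusMeasure d) (UnitAddTorus.mFourier k) (star φ)) (f : L2Torus d) := by
      refine (denseRange_polyToHardy d).equalizer
        (continuous_const.inner (continuous_subtype_val.comp Γ.continuous))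
        (continuous_const.inner continuous_subtype_val) (funext fun p => ?_)
      change inner ℂ (torusChar k) (Γ (polyToHardy d p) : L2Torus d) = _
      rw [hΓ.apply_polyToHardy, hP, inner_torusChar_mulOp]
      rfl
    rw [hP, inner_torusChar_mulOp, ← hf]
    exact congrFun h1 f

lemma exists_mFourier_mul_mem_analyticPoly (j : Fin d) {p : C(UnitAddTorus (Fin d), ℂ)}
    (hp : p ∈ polySpace {k : Fin d → ℤ | 0 ≤ k j}) :
    ∃ n : Fin d → ℤ, (∀ i, 0 ≤ n i) ∧ n j = 0 ∧ UnitAddTorus.mFourier n * p ∈ analyticPoly d := by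
  have hmul : ∀ n : Fin d → ℤ, (∀ i, 0 ≤ n i) → ∀ q ∈ analyticPoly d,
      UnitAddTorus.mFourier n * q ∈ analyticPoly d := fun n hn q hq =>
    polySpace_mul (Λ := {k | ∀ j, 0 ≤ k j}) (Λ' := {k | ∀ j, 0 ≤ k j})
      (Λ'' := {k | ∀ j, 0 ≤ k j}) (fun n hn k hk i => add_nonneg (hn i) (hk i))
      (mFourier_mem_polySpace hn) hq
  induction hp using Submodule.span_induction with
  | mem x hx =>
    obtain ⟨k, hk, rfl⟩ := hx
    refine ⟨fun i => if i = j then 0 else |k i|, fun i => ?_, if_pos rfl, ?_⟩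
    · dsimp only
      split_ifs <;> positivity
    · rw [mFourier_mul_mFourier]
      refine mFourier_mem_polySpace fun i => ?_
      rw [Pi.add_apply]
      split_ifs with hi
      · rw [hi, zero_add]; exact hk
      · linarith [neg_abs_le (k i)]
  | zero => exact ⟨0, fun _ => le_rfl, rfl, by rw [mul_zero]; exact zero_mem _⟩
  | add x y _ _ hx hy =>
    obtain ⟨n, hn, hnj, h1⟩ := hx
    obtain ⟨m, hm, hmj, h2⟩ := hy
    refine ⟨n + m, fun i => add_nonneg (hn i) (hm i), by simp [hnj, hmj], ?_⟩
    rw [← mFourier_mul_mFourier, mul_add]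
    refine add_mem ?_ ?_
    · rw [mul_right_comm, mul_comm]
      exact hmul m hm _ h1
    · rw [mul_assoc]
      exact hmul n hn _ h2
  | smul c x _ hx =>
    obtain ⟨n, hn, hnj, h1⟩ := hx
    exact ⟨n, hn, hnj, by rw [mul_smul_comm]; exact Submodule.smul_mem _ _ h1⟩

lemma projIn_mulOp_mFourier {j : Fin d} {n : Fin d → ℤ} (hn : n j = 0) (f : L2Torus d) :
    projIn j (mulOp (torusMeasure d) (UnitAddTorus.mFourier n) f) =
      mulOp (torusMeasure d) (UnitAddTorus.mFourier n) (projIn j f) := by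
  classical
  refine ext_inner_torusChar fun k => ?_
  rw [inner_torusChar_mulOp_mFourier, projIn, inner_torusChar_starProjection,
    inner_torusChar_starProjection, inner_torusChar_mulOp_mFourier]
  simp [hn]

/-- A bound for the Hankel operator with symbol `φ` is a bound for `p ↦ (I - P_{x_j}) (p φ)` on
the larger space of the polynomials that are analytic in `x_j`, as this map commutes with the
characters in the other variables. -/
lemma norm_sub_projIn_le_of_norm_sub_projH2_le {φ : L2Torus d} {M : ℝ}
    (h : ∀ p ∈ analyticPoly d,
      ‖mulOp (torusMeasure d) p φ - projH2 d (mulOp (torusMeasure d) p φ)‖ ≤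
        M * ‖ContinuousMap.toLp 2 (torusMeasure d) ℂ p‖) (j : Fin d)
    {p : C(UnitAddTorus (Fin d), ℂ)} (hp : p ∈ polySpace {k : Fin d → ℤ | 0 ≤ k j}) :
    ‖mulOp (torusMeasure d) p φ - projIn j (mulOp (torusMeasure d) p φ)‖ ≤
      M * ‖ContinuousMap.toLp 2 (torusMeasure d) ℂ p‖ := by
  obtain ⟨n, -, hnj, hn⟩ := exists_mFourier_mul_mem_analyticPoly j hp
  have h1 := h _ hn
  rw [← mulOp_toLp, norm_mulOp_of_norm_one (norm_mFourier_apply n)] at h1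
  refine le_trans ?_ h1
  rw [← norm_mulOp_of_norm_one (norm_mFourier_apply n), map_sub, ← projIn_mulOp_mFourier hnj,
    ← mulOp_mul, ← sub_projIn_sub_projH2]
  exact norm_sub_projIn_le j _

end Hankel

/-! ### Averages over one variable -/

section Average

variable {d : ℕ}

/-- The average over the variable `x_k`, that is, the projection onto the functions that do not
depend on `x_k`. -/
def avgIn (k : Fin d) : L2Torus d →L[ℂ] L2Torus d :=
  (spectralSubspace {n : Fin d → ℤ | n k = 0}).starProjection

lemma inner_avgIn (k : Fin d) (f g : L2Torus d) :
    inner ℂ (avgIn k f) g = inner ℂ f (avgIn k g) :=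
  Submodule.inner_starProjection_left_eq_right _ f g

lemma integral_fourier (n : ℤ) :
    ∫ t, fourier n t ∂(AddCircle.haarAddCircle : Measure UnitAddCircle) =
      if n = 0 then (1 : ℂ) else 0 := by
  have h := orthonormal_iff_ite.1 (orthonormal_fourier (T := 1)) 0 n
  rw [ContinuousMap.inner_toLp] at h
  simpa [eq_comm] using h

lemma mFourier_add_single (n : Fin d → ℤ) (x : UnitAddTorus (Fin d)) (k : Fin d)
    (t : UnitAddCircle) : UnitAddTorus.mFourier n (x + Pi.single k t) =
      fourier (n k) t * UnitAddTorus.mFourier n x := by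
  have h : fourier (n k) t = ∏ i, fourier (n i) ((Pi.single k t : UnitAddTorus (Fin d)) i) := by
    rw [Finset.prod_eq_single k]
    · rw [Pi.single_eq_same]
    · intro i _ hi
      rw [Pi.single_eq_of_ne hi, fourier_eval_zero]
    · simp
  rw [h]
  simp only [UnitAddTorus.mFourier, ContinuousMap.coe_mk, ← Finset.prod_mul_distrib]
  refine Finset.prod_congr rfl fun i _ => ?_
  simp only [Pi.add_apply, fourier_apply, smul_add, AddCircle.toCircle_add, Circle.coe_mul]
  ring

lemma continuous_add_single (k : Fin d) :
    Continuous fun z : UnitAddTorus (Fin d) × UnitAddCircle => z.1 + Pi.single k z.2 :=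
  continuous_fst.add ((continuous_single k).comp continuous_snd)

lemma exists_avgIn_toLp_eq (k : Fin d) {p : C(UnitAddTorus (Fin d), ℂ)}
    (hp : p ∈ polySpace (Set.univ : Set (Fin d → ℤ))) :
    ∃ q : C(UnitAddTorus (Fin d), ℂ),
      avgIn k (ContinuousMap.toLp 2 (torusMeasure d) ℂ p) =
        ContinuousMap.toLp 2 (torusMeasure d) ℂ q ∧
      ∀ x, q x = ∫ t, p (x + Pi.single k t) ∂AddCircle.haarAddCircle := by
  have hint : ∀ (p : C(UnitAddTorus (Fin d), ℂ)) x,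
      Integrable (fun t => p (x + Pi.single k t)) AddCircle.haarAddCircle := fun p x =>
    (p.continuous.comp ((continuous_add_single k).comp
      (Continuous.prodMk_right x))).integrable_of_hasCompactSupport
        (HasCompactSupport.of_compactSpace _)
  induction hp using Submodule.span_induction with
  | mem p hp =>
    obtain ⟨n, -, rfl⟩ := hp
    simp_rw [mFourier_add_single, integral_mul_const, integral_fourier]
    rw [← torusChar_eq_toLp]
    by_cases hn : n k = 0
    · exact ⟨_, starProjection_eq_self (torusChar_mem hn), fun x => by rw [if_pos hn, one_mul]⟩
    · refine ⟨0, ?_, fun x => by rw [if_neg hn, zero_mul, ContinuousMap.zero_apply]⟩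
      rw [map_zero]
      exact starProjection_eq_zero (Λ' := {n}) (by simpa using hn)
        (torusChar_mem (Set.mem_singleton n))
  | zero => exact ⟨0, by simp, by simp⟩
  | add p p' _ _ h h' =>
    obtain ⟨q, h1, h2⟩ := h
    obtain ⟨q', h1', h2'⟩ := h'
    refine ⟨q + q', by simp only [map_add, h1, h1'], fun x => ?_⟩
    simp only [ContinuousMap.add_apply]
    rw [integral_add (hint p x) (hint p' x), h2, h2']
  | smul c p _ h =>
    obtain ⟨q, h1, h2⟩ := h
    refine ⟨c • q, by simp only [map_smul, h1], fun x => ?_⟩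
    simp only [ContinuousMap.smul_apply]
    rw [integral_smul, h2]

lemma integral_norm_le_of_eq_average (k : Fin d) {p q : C(UnitAddTorus (Fin d), ℂ)}
    (h : ∀ x, q x = ∫ t, p (x + Pi.single k t) ∂AddCircle.haarAddCircle) :
    ∫ x, ‖q x‖ ∂torusMeasure d ≤ ∫ x, ‖p x‖ ∂torusMeasure d := by
  have hc : Continuous fun z : UnitAddTorus (Fin d) × UnitAddCircle =>
      ‖p (z.1 + Pi.single k z.2)‖ :=
    (p.continuous.comp (continuous_add_single k)).norm
  have hint : Integrable (fun z : UnitAddTorus (Fin d) × UnitAddCircle =>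
      ‖p (z.1 + Pi.single k z.2)‖) ((torusMeasure d).prod AddCircle.haarAddCircle) :=
    hc.integrable_of_hasCompactSupport (HasCompactSupport.of_compactSpace _)
  calc ∫ x, ‖q x‖ ∂torusMeasure d
      ≤ ∫ x, ∫ t, ‖p (x + Pi.single k t)‖ ∂AddCircle.haarAddCircle ∂torusMeasure d := by
        refine integral_mono (q.continuous.norm.integrable_of_hasCompactSupport
          (HasCompactSupport.of_compactSpace _)) hint.integral_prod_left fun x => ?_
        rw [h x]
        exact norm_integral_le_integral_norm _
    _ = ∫ t, ∫ x, ‖p (x + Pi.single k t)‖ ∂torusMeasure d ∂AddCircle.haarAddCircle :=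
        integral_integral_swap hint
    _ = ∫ x, ‖p x‖ ∂torusMeasure d := by
        have : ∀ t : UnitAddCircle, ∫ x, ‖p (x + Pi.single k t)‖ ∂torusMeasure d =
            ∫ x, ‖p x‖ ∂torusMeasure d := fun t =>
          integral_add_right_eq_self (fun x => ‖p x‖) (Pi.single k t)
        simp [this]

/-- Averages over one of the variables preserve the bounded functions. By duality, this amounts to
the fact that they are contractions in the norm of `L¹`. -/
lemma memLp_top_avgIn (k : Fin d) {g : L2Torus d} (hg : MemLp g ∞ (torusMeasure d)) :
    MemLp (avgIn k g) ∞ (torusMeasure d) := by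
  set M := (eLpNorm g ∞ (torusMeasure d)).toReal
  have hgM : ∀ᵐ x ∂torusMeasure d, ‖g x‖ ≤ M := by
    filter_upwards [ae_le_eLpNormEssSup (f := g) (μ := torusMeasure d)] with x hx
    rw [← eLpNorm_exponent_top] at hx
    rw [← toReal_enorm]
    exact ENNReal.toReal_mono hg.2.ne hx
  refine ⟨Lp.aestronglyMeasurable _, (eLpNorm_top_le_of_inner_le (M := M)
    ENNReal.toReal_nonneg fun F => ?_).trans_lt ENNReal.ofReal_lt_top⟩
  have hclosed : IsClosed {F | ‖inner ℂ (avgIn k g) F‖ ≤ M * ∫ x, ‖F x‖ ∂torusMeasure d} := by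
    simp_rw [← norm_inclL1]
    exact isClosed_le (continuous_const.inner continuous_id).norm
      (continuous_const.mul (inclL1 (torusMeasure d)).continuous.norm)
  refine closure_minimal ?_ hclosed (spectralSubspace_le_closure Set.univ
    (mem_spectralSubspace.2 fun k hk => absurd (Set.mem_univ k) hk))
  rintro _ ⟨p, hp, rfl⟩
  obtain ⟨q, hq, hqp⟩ := exists_avgIn_toLp_eq k hp
  have hae := ContinuousMap.coeFn_toLp (p := 2) (𝕜 := ℂ) (torusMeasure d) p
  have hae' := ContinuousMap.coeFn_toLp (p := 2) (𝕜 := ℂ) (torusMeasure d) q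
  change ‖inner ℂ (avgIn k g) (ContinuousMap.toLp 2 (torusMeasure d) ℂ p)‖ ≤
    M * ∫ x, ‖ContinuousMap.toLp 2 (torusMeasure d) ℂ p x‖ ∂torusMeasure d
  rw [inner_avgIn, hq, integral_congr_ae (hae.mono fun x hx => congrArg norm hx), L2.inner_def]
  calc ‖∫ x, inner ℂ (g x) (ContinuousMap.toLp 2 (torusMeasure d) ℂ q x) ∂torusMeasure d‖
      ≤ ∫ x, M * ‖q x‖ ∂torusMeasure d := by
        refine norm_integral_le_of_norm_le ((q.continuous.norm.integrable_of_hasCompactSupport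
          (HasCompactSupport.of_compactSpace _)).const_mul M) ?_
        filter_upwards [hgM, hae'] with x h1 h2
        rw [h2]
        exact (norm_inner_le_norm _ _).trans (by gcongr)
    _ = M * ∫ x, ‖q x‖ ∂torusMeasure d := integral_const_mul _ _
    _ ≤ _ := mul_le_mul_of_nonneg_left (integral_norm_le_of_eq_average k hqp)
        ENNReal.toReal_nonneg

end Average

/-! ### Blaschke products as multipliers -/

section Blaschke

variable {d : ℕ}

lemma blaschkeFactor_mul (a : Complex.UnitDisc) :
    blaschkeFactor a * (1 - conj (a : ℂ) • fourier 1) = fourier 1 - (a : ℂ) • 1 := by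
  ext t
  have h : 1 - conj (a : ℂ) * fourier 1 t ≠ 0 := fun h => by
    have h1 : conj (a : ℂ) * fourier 1 t = 1 := (sub_eq_zero.mp h).symm
    have h2 := congrArg norm h1
    rw [norm_mul, RCLike.norm_conj, fourier_apply, Circle.norm_coe, mul_one, norm_one] at h2
    exact a.norm_ne_one h2
  change (fourier 1 t - (a : ℂ)) / (1 - conj (a : ℂ) * fourier 1 t) *
    (1 - conj (a : ℂ) * fourier 1 t) = fourier 1 t - (a : ℂ) * 1
  rw [div_mul_cancel₀ _ h, mul_one]

lemma norm_blaschkeFactor (a : Complex.UnitDisc) (t : UnitAddCircle) :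
    ‖blaschkeFactor a t‖ = 1 := by
  have hz : ‖fourier 1 t‖ = 1 := by rw [fourier_apply, Circle.norm_coe]
  have hzz : conj (fourier 1 t) * fourier 1 t = 1 := by
    rw [mul_comm, Complex.mul_conj, Complex.normSq_eq_norm_sq, hz]; norm_num
  have h : 1 - conj (a : ℂ) * fourier 1 t ≠ 0 := fun h => by
    have h1 : conj (a : ℂ) * fourier 1 t = 1 := (sub_eq_zero.mp h).symm
    have h2 := congrArg norm h1
    rw [norm_mul, RCLike.norm_conj, hz, mul_one, norm_one] at h2
    exact a.norm_ne_one h2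
  change ‖(fourier 1 t - (a : ℂ)) / (1 - conj (a : ℂ) * fourier 1 t)‖ = 1
  have h3 : 1 - conj (a : ℂ) * fourier 1 t = conj (fourier 1 t - (a : ℂ)) * fourier 1 t := by
    rw [map_sub, sub_mul, hzz]
  rw [norm_div, div_eq_one_iff_eq (norm_ne_zero_iff.2 h), h3, norm_mul, RCLike.norm_conj, hz,
    mul_one]

/-- To prove a property of Blaschke products, it suffices to treat the unimodular constants, the
Blaschke factors and products. -/
lemma IsBlaschkeProduct.induction {Q : C(UnitAddCircle, ℂ) → Prop}
    (hconst : ∀ c : Circle, Q ((c : ℂ) • 1)) (hmul : ∀ g h, Q g → Q h → Q (g * h))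
    (hfac : ∀ a, Q (blaschkeFactor a)) {N : ℕ} {b : C(UnitAddCircle, ℂ)}
    (hb : IsBlaschkeProduct N b) : Q b := by
  obtain ⟨c, s, -, rfl⟩ := hb
  induction s using Multiset.induction with
  | empty => exact hconst c
  | cons a s ih =>
    rw [Multiset.map_cons, Multiset.prod_cons, mul_comm, ← smul_mul_assoc]
    exact hmul _ _ ih (hfac a)

/-- The Blaschke factor with zero `a` in the variable `x_k`. -/
def blaschkeIn (k : Fin d) (a : Complex.UnitDisc) : C(UnitAddTorus (Fin d), ℂ) :=
  (blaschkeFactor a).comp (ContinuousMap.eval k)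

lemma tensorFun_induction {Q : C(UnitAddTorus (Fin d), ℂ) → Prop}
    (hconst : ∀ c : Circle, Q ((c : ℂ) • 1)) (hmul : ∀ g h, Q g → Q h → Q (g * h))
    (hfac : ∀ k a, Q (blaschkeIn k a))
    {n : Fin d → ℕ} {b : Fin d → C(UnitAddCircle, ℂ)} (hb : ∀ k, IsBlaschkeProduct (n k) (b k)) :
    Q (tensorFun b) := by
  rw [tensorFun]
  refine Finset.prod_induction _ Q hmul ?_ fun k _ => ?_
  · simpa using hconst 1
  · exact (hb k).induction (Q := fun g => Q (g.comp (ContinuousMap.eval k)))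
      hconst (fun g h => hmul _ _) (hfac k)

lemma norm_tensorFun_apply {n : Fin d → ℕ} {b : Fin d → C(UnitAddCircle, ℂ)}
    (hb : ∀ k, IsBlaschkeProduct (n k) (b k)) (x : UnitAddTorus (Fin d)) :
    ‖tensorFun b x‖ = 1 :=
  tensorFun_induction (Q := fun g => ‖g x‖ = 1) (fun c => by simp [Circle.norm_coe])
    (fun g h hg hh => by rw [ContinuousMap.mul_apply, norm_mul, hg, hh, one_mul])
    (fun k a => norm_blaschkeFactor a _) hb

lemma blaschkeFactor_comp_eval_mul (k : Fin d) (a : Complex.UnitDisc) :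
    blaschkeIn k a *
      (1 - conj (a : ℂ) • UnitAddTorus.mFourier (Pi.single k 1)) =
        UnitAddTorus.mFourier (Pi.single k 1) - (a : ℂ) • 1 := by
  ext x
  have h := DFunLike.congr_fun (blaschkeFactor_mul a) (x k)
  have h2 := UnitAddTorus.mFourier_single x k
  simp only [ContinuousMap.mul_apply, ContinuousMap.sub_apply, ContinuousMap.smul_apply] at h ⊢
  rw [h2]
  exact h

lemma mulOp_blaschkeFactor_mem (k : Fin d) (a : Complex.UnitDisc) {Λ : Set (Fin d → ℤ)}
    (hΛ : ∀ n ∈ Λ, Pi.single k 1 + n ∈ Λ) {f : L2Torus d} (hf : f ∈ spectralSubspace Λ) :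
    mulOp (torusMeasure d) (blaschkeIn k a) f ∈
      spectralSubspace Λ :=
  mulOp_mem_of_one_sub_smul_mul (norm_mFourier_apply (Pi.single k 1))
    (fun _ hf => mulOp_mFourier_mem hΛ hf) (by rw [RCLike.norm_conj]; exact a.norm_lt_one)
    (blaschkeFactor_comp_eval_mul k a) hf

lemma single_nonneg (k j : Fin d) : 0 ≤ (Pi.single k 1 : Fin d → ℤ) j := by
  rw [Pi.single_apply]
  split_ifs <;> simp

lemma mulOp_blaschkeFactor_mem_hardyIn (k : Fin d) (a : Complex.UnitDisc) (j : Fin d)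
    {f : L2Torus d} (hf : f ∈ hardyIn j) :
    mulOp (torusMeasure d) (blaschkeIn k a) f ∈ hardyIn j :=
  mulOp_blaschkeFactor_mem k a (Λ := {n | 0 ≤ n j})
    (fun n hn => show 0 ≤ _ + n j from add_nonneg (single_nonneg k j) hn) hf

lemma mulOp_tensorFun_mem_hardyIn {n : Fin d → ℕ} {b : Fin d → C(UnitAddCircle, ℂ)}
    (hb : ∀ k, IsBlaschkeProduct (n k) (b k)) (j : Fin d) {f : L2Torus d} (hf : f ∈ hardyIn j) :
    mulOp (torusMeasure d) (tensorFun b) f ∈ hardyIn j :=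
  tensorFun_induction (Q := fun g => ∀ f ∈ hardyIn j, mulOp (torusMeasure d) g f ∈ hardyIn j)
    (fun c f hf => by
      rw [map_smul, smul_apply, mulOp_one]
      exact Submodule.smul_mem _ _ hf)
    (fun g h hg hh f hf => by rw [mulOp_mul]; exact hg _ (hh _ hf))
    (fun k a _ => mulOp_blaschkeFactor_mem_hardyIn k a j) hb f hf

lemma mulOp_tensorFun_mem_hardy {n : Fin d → ℕ} {b : Fin d → C(UnitAddCircle, ℂ)}
    (hb : ∀ k, IsBlaschkeProduct (n k) (b k)) {f : L2Torus d} (hf : f ∈ hardy d) :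
    mulOp (torusMeasure d) (tensorFun b) f ∈ hardy d :=
  mem_hardy_iff.2 fun j => mulOp_tensorFun_mem_hardyIn hb j (mem_hardy_iff.1 hf j)

/-! ### `BMO_r` is stable under multiplication by Blaschke products -/

lemma projIn_mulOp_single_of_mem_compl (k : Fin d) {f : L2Torus d}
    (hf : f ∈ spectralSubspace {n : Fin d → ℤ | 0 ≤ n k}ᶜ) :
    projIn k (mulOp (torusMeasure d) (UnitAddTorus.mFourier (Pi.single k 1)) f) =
      avgIn k (mulOp (torusMeasure d) (UnitAddTorus.mFourier (Pi.single k 1)) f) := by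
  classical
  refine ext_inner_torusChar fun n => ?_
  rw [projIn, avgIn, inner_torusChar_starProjection, inner_torusChar_starProjection,
    inner_torusChar_mulOp_mFourier]
  by_cases hn : n k = 0
  · rw [if_pos (show n ∈ {n : Fin d → ℤ | 0 ≤ n k} from hn.ge),
      if_pos (show n ∈ {n : Fin d → ℤ | n k = 0} from hn)]
  · rw [if_neg (show n ∉ {n : Fin d → ℤ | n k = 0} from hn)]
    split_ifs with h
    · refine mem_spectralSubspace.1 hf _ (not_not.2 ?_)
      simp only [Set.mem_ofPred_eq, Pi.sub_apply, Pi.single_eq_same] at h ⊢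
      omega
    · rfl

lemma avgIn_mulOp_single_of_mem (k : Fin d) {f : L2Torus d} (hf : f ∈ hardyIn k) :
    avgIn k (mulOp (torusMeasure d) (UnitAddTorus.mFourier (Pi.single k 1)) f) = 0 := by
  refine starProjection_eq_zero (Λ' := {n : Fin d → ℤ | 1 ≤ n k})
    (Set.disjoint_left.2 fun n h1 h2 => ?_) (mulOp_mFourier_mem (fun n hn => ?_) hf)
  · simp only [Set.mem_ofPred_eq] at h1 h2
    omega
  · simp only [Set.mem_ofPred_eq, Pi.add_apply, Pi.single_eq_same] at hn ⊢
    omega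

/-- For a Blaschke factor `β` in `x_k`, the operator `P_{x_k} β (I - P_{x_k})` has rank one in
the variable `x_k`: with `z = exp (2 π i x_k)` it is
`g ↦ (1 - conj a z)⁻¹ E_k (z (1 + conj a β) g)`, where `E_k` is the average over `x_k`. -/
lemma one_sub_mulOp_projIn_mulOp_blaschkeFactor (k : Fin d) (a : Complex.UnitDisc)
    (g : L2Torus d) :
    mulOp (torusMeasure d) (1 - conj (a : ℂ) • UnitAddTorus.mFourier (Pi.single k 1))
      (projIn k (mulOp (torusMeasure d) (blaschkeIn k a)
        (g - projIn k g))) =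
    avgIn k (mulOp (torusMeasure d) (UnitAddTorus.mFourier (Pi.single k 1))
      (mulOp (torusMeasure d) (1 + conj (a : ℂ) • blaschkeIn k a)
        g)) := by
  have hβ := blaschkeFactor_comp_eval_mul k a
  have hβmem : ∀ f ∈ hardyIn k,
      mulOp (torusMeasure d) (blaschkeIn k a) f ∈ hardyIn k :=
    fun f hf => mulOp_blaschkeFactor_mem_hardyIn k a k hf
  set β := blaschkeIn k a
  set z := UnitAddTorus.mFourier (Pi.single k 1 : Fin d → ℤ)
  set c := conj (a : ℂ)
  have hneg : ∀ f : L2Torus d, f - projIn k f ∈ spectralSubspace {n : Fin d → ℤ | 0 ≤ n k}ᶜ :=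
    fun f => sub_starProjection_mem _ f
  have hPQ : ∀ f : L2Torus d, projIn k (f - projIn k f) = 0 := fun f =>
    starProjection_eq_zero disjoint_compl_right (hneg f)
  -- only the average sees the difference between `z f` and `z (I - P) f`
  have havg : ∀ f : L2Torus d,
      avgIn k (mulOp (torusMeasure d) z (f - projIn k f)) = avgIn k (mulOp (torusMeasure d) z f) :=
    fun f => by rw [map_sub, map_sub, avgIn_mulOp_single_of_mem k (projIn_mem k f), sub_zero]
  have hr : ∀ f : L2Torus d, mulOp (torusMeasure d) (1 - c • z) f =
      f - c • mulOp (torusMeasure d) z f := fun f => by simp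
  set v := g - projIn k g with hv
  set w := mulOp (torusMeasure d) β v with hw
  have h1 : projIn k (mulOp (torusMeasure d) (1 - c • z) w) =
      avgIn k (mulOp (torusMeasure d) z g) := by
    rw [hw, ← mulOp_mul, mul_comm, hβ]
    simp only [map_sub, map_smul, sub_apply, smul_apply,
      mulOp_one]
    rw [hPQ, smul_zero, sub_zero, projIn_mulOp_single_of_mem_compl k (hneg g), havg]
  have h2 : projIn k (mulOp (torusMeasure d) (1 - c • z) (projIn k w)) =
      mulOp (torusMeasure d) (1 - c • z) (projIn k w) := by
    refine starProjection_eq_self ?_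
    rw [hr]
    refine sub_mem (projIn_mem k w) (Submodule.smul_mem _ _
      (mulOp_mFourier_mem (fun n hn => ?_) (projIn_mem k w)))
    exact add_nonneg (single_nonneg k k) hn
  have h3 : projIn k (mulOp (torusMeasure d) (1 - c • z) (w - projIn k w)) =
      -(c • avgIn k (mulOp (torusMeasure d) z w)) := by
    rw [hr, map_sub, hPQ, zero_sub, map_smul, projIn_mulOp_single_of_mem_compl k (hneg w), havg]
  have h4 : avgIn k (mulOp (torusMeasure d) z w) =
      avgIn k (mulOp (torusMeasure d) z (mulOp (torusMeasure d) β g)) := by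
    rw [hw, hv, map_sub, map_sub, map_sub,
      avgIn_mulOp_single_of_mem k (hβmem _ (projIn_mem k g)), sub_zero]
  have h5 : projIn k (mulOp (torusMeasure d) (1 - c • z) w) =
      projIn k (mulOp (torusMeasure d) (1 - c • z) (projIn k w)) +
        projIn k (mulOp (torusMeasure d) (1 - c • z) (w - projIn k w)) := by
    rw [← map_add, ← map_add, add_sub_cancel]
  rw [h1, h2, h3, h4] at h5
  rw [← sub_eq_add_neg, eq_comm, sub_eq_iff_eq_add] at h5
  rw [h5]
  simp only [map_add, map_smul, add_apply, smul_apply,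
    mulOp_one]

lemma memLp_top_projIn_mulOp_blaschkeFactor (k : Fin d) (a : Complex.UnitDisc) {g : L2Torus d}
    (hg : MemLp g ∞ (torusMeasure d)) :
    MemLp (projIn k (mulOp (torusMeasure d) (blaschkeIn k a)
      (g - projIn k g))) ∞ (torusMeasure d) := by
  have h := one_sub_mulOp_projIn_mulOp_blaschkeFactor k a g
  have hβ := blaschkeFactor_comp_eval_mul k a
  set β := blaschkeIn k a
  set z := UnitAddTorus.mFourier (Pi.single k 1 : Fin d → ℤ)
  set c := conj (a : ℂ)
  set u := projIn k (mulOp (torusMeasure d) β (g - projIn k g))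
  have hac : 1 - c * a ≠ 0 := fun h0 => by
    have h1 := congrArg norm (sub_eq_zero.1 h0).symm
    rw [norm_mul, RCLike.norm_conj, norm_one] at h1
    nlinarith [a.norm_lt_one, norm_nonneg (a : ℂ)]
  -- `(1 + conj a β) (1 - conj a z) = 1 - |a|²`
  have hinv : ((1 - c * a)⁻¹ • (1 + c • β)) * (1 - c • z) = 1 := by
    ext x
    have h1 : β x * (1 - c * z x) = z x - a * 1 := DFunLike.congr_fun hβ x
    change (1 - c * a)⁻¹ * (1 + c * β x) * (1 - c * z x) = 1
    rw [mul_assoc, inv_mul_eq_iff_eq_mul₀ hac]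
    linear_combination c * h1
  have h2 : u = mulOp (torusMeasure d) ((1 - c * a)⁻¹ • (1 + c • β))
      (mulOp (torusMeasure d) (1 - c • z) u) := by
    rw [← mulOp_mul, hinv, mulOp_one]
  rw [h2, h]
  exact memLp_top_mulOp _ (memLp_top_avgIn k (memLp_top_mulOp _ (memLp_top_mulOp _ hg)))

/-- If `φ₀, φ_j` decompose `φ` and `β` is a Blaschke factor in `x_k`, then `β φ_j` and
`β φ₀ + P_{x_k} β (I - P_{x_k}) (φ_k - φ₀)` decompose `β φ`. The correction is due to the fact that
`β` does not preserve the kernel of `P`; it is bounded, although `P_{x_k}` does not preserve the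
bounded functions. -/
lemma MemBMOr.mulOp_blaschkeFactor {φ : L2Torus d} (hφ : MemBMOr φ) (k : Fin d)
    (a : Complex.UnitDisc) :
    MemBMOr (mulOp (torusMeasure d) (blaschkeIn k a) φ) := by
  classical
  obtain ⟨φ₀, ϕ, h⟩ := hφ
  have hmem := fun j f => mulOp_blaschkeFactor_mem_hardyIn (d := d) k a j (f := f)
  have hmem' := fun Λ hΛ f => mulOp_blaschkeFactor_mem (d := d) k a (Λ := Λ) hΛ (f := f)
  have htop : MemLp (ϕ k - φ₀) ∞ (torusMeasure d) :=
    (memLp_congr_ae (Lp.coeFn_sub (ϕ k) φ₀)).2 ((h.memLp k).sub h.memLp_zero)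
  have hu := memLp_top_projIn_mulOp_blaschkeFactor k a htop
  set β : C(UnitAddTorus (Fin d), ℂ) := blaschkeIn k a
  set u := projIn k (mulOp (torusMeasure d) β (ϕ k - φ₀ - projIn k (ϕ k - φ₀))) with hu_def
  refine ⟨mulOp (torusMeasure d) β φ₀ + u, fun j => mulOp (torusMeasure d) β (ϕ j), ?_,
    fun j => memLp_top_mulOp _ (h.memLp j), fun j => ?_, ?_⟩
  · exact (memLp_congr_ae (Lp.coeFn_add _ u)).2 ((memLp_top_mulOp β h.memLp_zero).add hu)
  · rw [sub_projIn_eq_iff, ← map_sub]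
    exact hmem j _ (sub_projIn_eq_iff.1 (h.antianalytic j))
  · have hana := h.analytic
    rw [projAll_eq_projH2] at hana ⊢
    set f := φ - φ₀ with hf
    have hPf : projH2 d f = 0 := by rw [hf, map_sub, hana, sub_self]
    have hQf : f - projIn k f = ϕ k - φ₀ - projIn k (ϕ k - φ₀) := by
      rw [sub_projIn_eq_iff, hf, sub_sub_sub_cancel_right]
      exact sub_projIn_eq_iff.1 (h.antianalytic k)
    -- `P_{x_k} f` has frequencies in a set that `P` annihilates and that `k ↦ k + e_k` preserves
    have h1 : projH2 d (mulOp (torusMeasure d) β (projIn k f)) = 0 := by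
      refine starProjection_eq_zero
        (Λ' := {n : Fin d → ℤ | 0 ≤ n k} ∩ {n | ∀ j, 0 ≤ n j}ᶜ)
        (Set.disjoint_left.2 fun n h1 h2 => h2.2 h1) (hmem' _ (fun n hn => ?_) _ ?_)
      · obtain ⟨i, hi⟩ := not_forall.1 hn.2
        have hik : i ≠ k := fun hik => hi (hik ▸ hn.1)
        refine ⟨add_nonneg (single_nonneg k k) hn.1, fun h' => hi ?_⟩
        have := h' i
        rwa [Pi.add_apply, Pi.single_eq_of_ne hik, zero_add] at this
      · rw [mem_spectralSubspace]
        intro n hn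
        rw [projIn, inner_torusChar_starProjection]
        split_ifs with hnk
        · have hn2 : n ∈ {n : Fin d → ℤ | ∀ j, 0 ≤ n j} := by
            by_contra h'
            exact hn ⟨hnk, h'⟩
          have h2 := inner_torusChar_starProjection (k := n) {n : Fin d → ℤ | ∀ j, 0 ≤ n j} f
          rw [if_pos hn2] at h2
          rw [← h2]
          exact (congrArg (inner ℂ (torusChar n)) hPf).trans (inner_zero_right _)
        · rfl
    have h2 : projH2 d (mulOp (torusMeasure d) β (f - projIn k f)) = projH2 d u := by
      rw [hQf, hu_def, projH2, projIn, starProjection_starProjection]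
      rw [Set.inter_eq_left.2]
      exact fun n (hn : ∀ j, 0 ≤ n j) => hn k
    have h3 : mulOp (torusMeasure d) β φ = mulOp (torusMeasure d) β φ₀ +
        (mulOp (torusMeasure d) β (projIn k f) + mulOp (torusMeasure d) β (f - projIn k f)) := by
      rw [← map_add, ← map_add, add_sub_cancel, hf, add_sub_cancel]
    rw [h3, map_add, map_add, map_add, h1, h2, zero_add]

lemma MemBMOr.smul {φ : L2Torus d} (hφ : MemBMOr φ) (c : ℂ) : MemBMOr (c • φ) := by
  obtain ⟨φ₀, ϕ, h⟩ := hφ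
  refine ⟨c • φ₀, fun j => c • ϕ j, ?_, fun j => ?_, fun j => ?_, ?_⟩
  · exact (memLp_congr_ae (Lp.coeFn_smul c φ₀)).2 (h.memLp_zero.const_smul c)
  · exact (memLp_congr_ae (Lp.coeFn_smul c (ϕ j))).2 ((h.memLp j).const_smul c)
  · rw [map_smul, map_smul, ← smul_sub, ← smul_sub, h.antianalytic j]
  · rw [map_smul, map_smul, h.analytic]

lemma MemBMOr.mulOp_tensorFun {φ : L2Torus d} (hφ : MemBMOr φ) {n : Fin d → ℕ}
    {b : Fin d → C(UnitAddCircle, ℂ)} (hb : ∀ k, IsBlaschkeProduct (n k) (b k)) :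
    MemBMOr (mulOp (torusMeasure d) (tensorFun b) φ) :=
  tensorFun_induction (Q := fun g => ∀ φ, MemBMOr φ → MemBMOr (mulOp (torusMeasure d) g φ))
    (fun c φ hφ => by
      rw [map_smul, smul_apply, mulOp_one]
      exact hφ.smul _)
    (fun g h hg hh φ hφ => by rw [mulOp_mul]; exact hg _ (hh _ hφ))
    (fun k a _ hφ => hφ.mulOp_blaschkeFactor k a) hb φ hφ

end Blaschke

/-! ### Codimensions -/

section LinearAlgebra

variable {H : Type*} [AddCommGroup H] [Module ℂ H]

lemma rank_quotient_map {T : H →ₗ[ℂ] H} (hT : Function.Injective T) (V : Submodule ℂ H) :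
    Module.rank ℂ (H ⧸ V.map T) =
      Module.rank ℂ (H ⧸ V) + Module.rank ℂ (H ⧸ LinearMap.range T) := by
  have hle : V.map T ≤ LinearMap.range T := LinearMap.map_le_range
  rw [← Submodule.rank_quotient_add_rank ((LinearMap.range T).map (V.map T).mkQ),
    (Submodule.quotientQuotientEquivQuotient _ _ hle).rank_eq, add_comm]
  congr 1
  have hker : LinearMap.ker ((V.map T).mkQ ∘ₗ T) = V := by
    rw [LinearMap.ker_comp, Submodule.ker_mkQ, Submodule.comap_map_eq_of_injective hT]
  rw [← LinearMap.range_comp, ← (LinearMap.quotKerEquivRange _).rank_eq,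
    (Submodule.quotEquivOfEq _ _ hker).rank_eq]

lemma rank_quotient_comap {T : H →ₗ[ℂ] H} (hT : Function.Injective T)
    (hrank : Module.rank ℂ (H ⧸ LinearMap.range T) = 1) {V : Submodule ℂ H}
    (hV : V ≤ LinearMap.range T) {N : ℕ} (hN : Module.rank ℂ (H ⧸ V) = (N + 1 : ℕ)) :
    Module.rank ℂ (H ⧸ V.comap T) = N := by
  have h1 := rank_quotient_map hT (V.comap T)
  rw [Submodule.map_comap_eq_of_le hV, hN, hrank, Nat.cast_succ] at h1
  exact (Cardinal.add_one_inj.1 h1).symm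

lemma mem_of_functional_eq_zero {R : Submodule ℂ H} (hrank : Module.rank ℂ (H ⧸ R) = 1)
    {ℓ : H →ₗ[ℂ] ℂ} (hℓ : ∀ f ∈ R, ℓ f = 0) (h0 : ℓ ≠ 0) {f : H} (hf : ℓ f = 0) : f ∈ R := by
  obtain ⟨u, hu⟩ : ∃ u, ℓ u ≠ 0 := by
    by_contra! h
    exact h0 (LinearMap.ext h)
  by_contra hfR
  have h1 : (Submodule.Quotient.mk f : H ⧸ R) ≠ 0 :=
    fun h => hfR ((Submodule.Quotient.mk_eq_zero _).1 h)
  obtain ⟨c, hc⟩ := (finrank_eq_one_iff_of_nonzero' _ h1).1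
    (Module.rank_eq_one_iff_finrank_eq_one.1 hrank) (Submodule.Quotient.mk u)
  rw [← Submodule.Quotient.mk_smul, Submodule.Quotient.eq] at hc
  have h2 := hℓ _ hc
  rw [map_sub, map_smul, hf, smul_zero, zero_sub, neg_eq_zero] at h2
  exact hu h2

variable [TopologicalSpace H]

lemma map_mem_comap_of_commute {S T : H →L[ℂ] H} (h : ∀ f, S (T f) = T (S f))
    {V : Submodule ℂ H} (hV : ∀ f ∈ V, S f ∈ V) {f : H} (hf : f ∈ V.comap T.toLinearMap) :
    S f ∈ V.comap T.toLinearMap := by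
  rw [Submodule.mem_comap, ContinuousLinearMap.coe_coe] at hf ⊢
  exact h f ▸ hV _ hf

lemma apply_mem_of_mem_comap {T : H →L[ℂ] H} {V : Submodule ℂ H} {f : H}
    (hf : f ∈ V.comap T.toLinearMap) : T f ∈ V := hf

lemma rank_quotient_comap_toLinearMap {T : H →L[ℂ] H} (hT : Function.Injective T)
    (hrank : Module.rank ℂ (H ⧸ LinearMap.range T.toLinearMap) = 1) {V : Submodule ℂ H}
    (hV : V ≤ LinearMap.range T.toLinearMap) {N : ℕ}
    (hN : Module.rank ℂ (H ⧸ V) = (N + 1 : ℕ)) :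
    Module.rank ℂ (H ⧸ V.comap T.toLinearMap) = N := rank_quotient_comap hT hrank hV hN

end LinearAlgebra

/-! ### The Hardy space of one variable -/

section Circle

/-- The characters of the circle, in `L²(𝕋)`. -/
def circleChar (n : ℤ) : L2Circle := fourierLp 2 n

lemma circleChar_eq_toLp (n : ℤ) :
    circleChar n = ContinuousMap.toLp 2 AddCircle.haarAddCircle ℂ (fourier n) := rfl

lemma orthonormal_circleChar : Orthonormal ℂ circleChar := orthonormal_fourier

lemma mem_hardyCircle {f : L2Circle} :
    f ∈ hardyCircle ↔ ∀ k < 0, inner ℂ (circleChar k) f = 0 :=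
  forall₂_congr fun k _ => by rw [fourierCoeff_eq_inner]; rfl

lemma ext_inner_circleChar {f g : L2Circle}
    (h : ∀ k, inner ℂ (circleChar k) f = inner ℂ (circleChar k) g) : f = g := by
  refine (fourierBasis (T := 1)).repr.injective (lp.ext (funext fun k => ?_))
  rw [HilbertBasis.repr_apply_apply, HilbertBasis.repr_apply_apply, coe_fourierBasis]
  exact h k

instance : CompleteSpace hardyCircle := by
  have h : (hardyCircle : Set L2Circle) =
      ⋂ k ∈ {k : ℤ | k < 0}, {f | inner ℂ (circleChar k) f = 0} := by
    ext f
    simp only [Set.mem_iInter]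
    exact mem_hardyCircle
  have h2 : IsClosed (hardyCircle : Set L2Circle) := by
    rw [h]
    exact isClosed_biInter fun k _ =>
      isClosed_eq (continuous_const.inner continuous_id) continuous_const
  exact h2.completeSpace_coe

lemma norm_fourier_apply (n : ℤ) (t : UnitAddCircle) : ‖fourier n t‖ = 1 := by
  rw [fourier_apply, Circle.norm_coe]

lemma mulOp_fourier_circleChar (n k : ℤ) :
    mulOp AddCircle.haarAddCircle (fourier n) (circleChar k) = circleChar (n + k) := by
  rw [circleChar_eq_toLp, mulOp_toLp, circleChar_eq_toLp]
  congr 1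
  ext t
  rw [ContinuousMap.mul_apply, fourier_add]

lemma inner_circleChar_mulOp_fourier (n k : ℤ) (f : L2Circle) :
    inner ℂ (circleChar k) (mulOp AddCircle.haarAddCircle (fourier n) f) =
      inner ℂ (circleChar (k - n)) f := by
  have h : star (fourier n : C(UnitAddCircle, ℂ)) = fourier (-n) := by
    ext t
    rw [fourier_neg]; rfl
  rw [inner_mulOp_right, h, mulOp_fourier_circleChar, neg_add_eq_sub]

lemma mulOp_fourier_mem_hardyCircle {n : ℤ} (hn : 0 ≤ n) {f : L2Circle} (hf : f ∈ hardyCircle) :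
    mulOp AddCircle.haarAddCircle (fourier n) f ∈ hardyCircle := by
  rw [mem_hardyCircle] at hf ⊢
  intro k hk
  rw [inner_circleChar_mulOp_fourier]
  exact hf _ (by omega)

lemma circleChar_mem {n : ℤ} (hn : 0 ≤ n) : circleChar n ∈ hardyCircle := by
  rw [mem_hardyCircle]
  intro k hk
  rw [orthonormal_iff_ite.1 orthonormal_circleChar, if_neg (by omega)]

/-- The analytic multipliers: the continuous functions `g` with `g H²(𝕋) ⊆ H²(𝕋)`. -/
def analyticMultiplier : Submonoid C(UnitAddCircle, ℂ) where
  carrier := {g | ∀ f ∈ hardyCircle, mulOp AddCircle.haarAddCircle g f ∈ hardyCircle}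
  one_mem' f hf := by rwa [mulOp_one]
  mul_mem' hg hh f hf := by rw [mulOp_mul]; exact hg _ (hh f hf)

lemma fourier_one_mem : fourier 1 ∈ analyticMultiplier :=
  fun _ hf => mulOp_fourier_mem_hardyCircle zero_le_one hf

lemma blaschkeFactor_mem (a : Complex.UnitDisc) : blaschkeFactor a ∈ analyticMultiplier :=
  fun _ hf => mulOp_mem_of_one_sub_smul_mul (norm_fourier_apply 1) fourier_one_mem
    (by rw [RCLike.norm_conj]; exact a.norm_lt_one) (blaschkeFactor_mul a) hf

lemma smul_one_mem_analyticMultiplier (c : ℂ) : c • 1 ∈ analyticMultiplier := fun f hf => by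
  rw [map_smul, smul_apply, mulOp_one]
  exact Submodule.smul_mem _ _ hf

lemma IsBlaschkeProduct.mem_analyticMultiplier {N : ℕ} {b : C(UnitAddCircle, ℂ)}
    (hb : IsBlaschkeProduct N b) : b ∈ analyticMultiplier :=
  hb.induction (Q := (· ∈ analyticMultiplier)) (fun c => smul_one_mem_analyticMultiplier c)
    (fun _ _ => mul_mem) blaschkeFactor_mem

lemma IsBlaschkeProduct.norm_apply {N : ℕ} {b : C(UnitAddCircle, ℂ)}
    (hb : IsBlaschkeProduct N b) (t : UnitAddCircle) : ‖b t‖ = 1 :=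
  hb.induction (Q := fun g => ‖g t‖ = 1) (fun c => by simp [Circle.norm_coe])
    (fun g h hg hh => by rw [ContinuousMap.mul_apply, norm_mul, hg, hh, one_mul])
    (fun a => norm_blaschkeFactor a t)

/-- Multiplication by an analytic multiplier, as an operator on `H²(𝕋)`. -/
def mulHardy (g : analyticMultiplier) : hardyCircle →L[ℂ] hardyCircle :=
  (mulOp AddCircle.haarAddCircle (g : C(UnitAddCircle, ℂ))).restrict g.2

lemma coe_mulHardy (g : analyticMultiplier) (f : hardyCircle) :
    (mulHardy g f : L2Circle) = mulOp AddCircle.haarAddCircle (g : C(UnitAddCircle, ℂ)) f := rfl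

lemma mulHardy_mul (g h : analyticMultiplier) (f : hardyCircle) :
    mulHardy (g * h) f = mulHardy g (mulHardy h f) := Subtype.ext (mulOp_mul _ _ _)

lemma norm_mulHardy {g : analyticMultiplier} (hg : ∀ t, ‖(g : C(UnitAddCircle, ℂ)) t‖ = 1)
    (f : hardyCircle) : ‖mulHardy g f‖ = ‖f‖ := norm_mulOp_of_norm_one hg (f : L2Circle)

lemma mulHardy_isometry {g : analyticMultiplier} (hg : ∀ t, ‖(g : C(UnitAddCircle, ℂ)) t‖ = 1) :
    Isometry (mulHardy g) := AddMonoidHomClass.isometry_of_norm _ (norm_mulHardy hg)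

lemma isClosed_range_mulHardy {g : analyticMultiplier}
    (hg : ∀ t, ‖(g : C(UnitAddCircle, ℂ)) t‖ = 1) :
    IsClosed (LinearMap.range (mulHardy g).toLinearMap : Set hardyCircle) := by
  rw [LinearMap.coe_range]
  exact (mulHardy_isometry hg).isClosedEmbedding.isClosed_range

/-- The unilateral shift. -/
def shiftHardy : hardyCircle →L[ℂ] hardyCircle := mulHardy ⟨fourier 1, fourier_one_mem⟩

lemma norm_shiftHardy (f : hardyCircle) : ‖shiftHardy f‖ = ‖f‖ :=
  norm_mulHardy (g := ⟨fourier 1, fourier_one_mem⟩) (norm_fourier_apply 1) f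

lemma coe_shiftHardy (f : hardyCircle) :
    (shiftHardy f : L2Circle) = mulOp AddCircle.haarAddCircle (fourier 1) f := rfl

lemma shiftHardy_mulHardy (g : analyticMultiplier) (f : hardyCircle) :
    shiftHardy (mulHardy g f) = mulHardy g (shiftHardy f) := Subtype.ext (mulOp_comm _ _ _)

lemma opNorm_shiftHardy_le : ‖shiftHardy‖ ≤ 1 :=
  shiftHardy.opNorm_le_bound zero_le_one fun f => by rw [norm_shiftHardy, one_mul]

lemma rank_quotient_range_shiftHardy :
    Module.rank ℂ (hardyCircle ⧸ LinearMap.range shiftHardy.toLinearMap) = 1 := by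
  let ev : hardyCircle →ₗ[ℂ] ℂ := (innerSL ℂ (circleChar 0)).toLinearMap ∘ₗ hardyCircle.subtype
  have hker : LinearMap.ker ev = LinearMap.range shiftHardy.toLinearMap := by
    ext f
    constructor
    · intro hf
      have hf0 : inner ℂ (circleChar 0) (f : L2Circle) = 0 := hf
      refine ⟨⟨mulOp AddCircle.haarAddCircle (fourier (-1)) f, mem_hardyCircle.2 fun k hk => ?_⟩,
        Subtype.ext (ext_inner_circleChar fun k => ?_)⟩
      · rw [inner_circleChar_mulOp_fourier]
        rcases (show k - -1 < 0 ∨ k - -1 = 0 by omega) with h | h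
        · exact mem_hardyCircle.1 f.2 _ h
        · rw [h, hf0]
      · change inner ℂ (circleChar k) (mulOp _ (fourier 1) (mulOp _ (fourier (-1)) _)) = _
        rw [inner_circleChar_mulOp_fourier, inner_circleChar_mulOp_fourier]
        congr 2
        ring
    · rintro ⟨g, rfl⟩
      change inner ℂ (circleChar 0) (mulOp _ (fourier 1) (g : L2Circle)) = 0
      rw [inner_circleChar_mulOp_fourier]
      exact mem_hardyCircle.1 g.2 _ (by norm_num)
  have hsurj : Function.Surjective ev := fun c => by
    refine ⟨c • ⟨circleChar 0, circleChar_mem le_rfl⟩, ?_⟩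
    change inner ℂ (circleChar 0) (c • circleChar 0) = c
    rw [inner_smul_right, orthonormal_iff_ite.1 orthonormal_circleChar, if_pos rfl, mul_one]
  rw [← hker, (ev.quotKerEquivOfSurjective hsurj).rank_eq, Module.rank_self]

/-- The shift `S` satisfies `S - a = (1 - a S*) S`, and `1 - a S*` is invertible for `|a| < 1`. -/
lemma rank_quotient_range_shiftHardy_sub {a : ℂ} (ha : ‖a‖ < 1) :
    Module.rank ℂ (hardyCircle ⧸ LinearMap.range (shiftHardy - a • 1).toLinearMap) = 1 := by
  let A : hardyCircle →L[ℂ] hardyCircle := ContinuousLinearMap.adjoint shiftHardy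
  have hA : ‖A‖ ≤ 1 := by
    rw [LinearIsometryEquiv.norm_map]
    exact opNorm_shiftHardy_le
  have hAS : ∀ f, A (shiftHardy f) = f := fun f => by
    have h := (ContinuousLinearMap.norm_map_iff_adjoint_comp_self shiftHardy).1 norm_shiftHardy
    exact DFunLike.congr_fun h f
  let w : hardyCircle →ₗ[ℂ] hardyCircle := LinearMap.id - a • A.toLinearMap
  have hwx : ∀ f, w f = f - a • A f := fun f => rfl
  have hinj : Function.Injective w := by
    rw [injective_iff_map_eq_zero]
    intro f hf
    rw [hwx, sub_eq_zero] at hf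
    by_contra h0
    have h1 : ‖f‖ ≤ ‖a‖ * ‖f‖ := by
      calc ‖f‖ = ‖a • A f‖ := by rw [← hf]
        _ ≤ ‖a‖ * ‖f‖ := by
          rw [norm_smul]
          gcongr
          exact (A.le_of_opNorm_le hA f).trans_eq (one_mul _)
    have h2 : 0 < ‖f‖ := norm_pos_iff.2 h0
    nlinarith
  have hsurj : LinearMap.range w = ⊤ := LinearMap.range_eq_top.2 fun f =>
    exists_sub_smul_apply_eq hA ha f
  have hmap : (LinearMap.range shiftHardy.toLinearMap).map w =
      LinearMap.range (shiftHardy - a • 1).toLinearMap := by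
    rw [← LinearMap.range_comp]
    congr 1
    ext1 f
    change shiftHardy f - a • A (shiftHardy f) = shiftHardy f - a • f
    rw [hAS]
  rw [← hmap, rank_quotient_map hinj, rank_quotient_range_shiftHardy, hsurj, rank_subsingleton',
    add_zero]

/-- A Blaschke factor as an analytic multiplier. -/
def blaschkeMultiplier (a : Complex.UnitDisc) : analyticMultiplier :=
  ⟨blaschkeFactor a, blaschkeFactor_mem a⟩

lemma mulHardy_blaschkeMultiplier_sub (a : Complex.UnitDisc) (u : hardyCircle) :
    mulHardy (blaschkeMultiplier a) (u - conj (a : ℂ) • shiftHardy u) =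
      shiftHardy u - (a : ℂ) • u :=
  Subtype.ext (mulOp_sub_smul_mulOp (blaschkeFactor_mul a) (u : L2Circle))

lemma range_mulHardy_blaschkeMultiplier (a : Complex.UnitDisc) :
    LinearMap.range (mulHardy (blaschkeMultiplier a)).toLinearMap =
      LinearMap.range (shiftHardy - (a : ℂ) • 1).toLinearMap := by
  have h1 := mulHardy_blaschkeMultiplier_sub a
  refine le_antisymm ?_ ?_
  · rintro _ ⟨f, rfl⟩
    have hc : ‖conj (a : ℂ)‖ < 1 := by rw [RCLike.norm_conj]; exact a.norm_lt_one
    obtain ⟨u, hu⟩ := exists_sub_smul_apply_eq opNorm_shiftHardy_le hc f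
    exact ⟨u, (h1 u).symm.trans (congrArg _ hu)⟩
  · rintro _ ⟨u, rfl⟩
    exact ⟨_, h1 u⟩

lemma rank_quotient_range_blaschkeMultiplier (a : Complex.UnitDisc) :
    Module.rank ℂ (hardyCircle ⧸
      LinearMap.range (mulHardy (blaschkeMultiplier a)).toLinearMap) = 1 := by
  rw [range_mulHardy_blaschkeMultiplier]
  exact rank_quotient_range_shiftHardy_sub a.norm_lt_one

lemma range_mulHardy_mul (g h : analyticMultiplier) :
    LinearMap.range (mulHardy (g * h)).toLinearMap =
      (LinearMap.range (mulHardy h).toLinearMap).map (mulHardy g).toLinearMap := by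
  rw [← LinearMap.range_comp]
  congr 1
  ext1 f
  exact mulHardy_mul g h f

/-- The codimension of `b H²(𝕋)` is the degree of the Blaschke product `b`. -/
lemma rank_quotient_range_mulHardy (c : Circle) (s : Multiset Complex.UnitDisc)
    {b : analyticMultiplier}
    (hb : (b : C(UnitAddCircle, ℂ)) = (c : ℂ) • (s.map blaschkeFactor).prod) :
    Module.rank ℂ (hardyCircle ⧸ LinearMap.range (mulHardy b).toLinearMap) = s.card := by
  induction s using Multiset.induction generalizing b with
  | empty =>
    have htop : LinearMap.range (mulHardy b).toLinearMap = ⊤ := by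
      refine LinearMap.range_eq_top.2 fun f => ⟨(c : ℂ)⁻¹ • f, Subtype.ext ?_⟩
      change mulOp _ (b : C(UnitAddCircle, ℂ)) ((c : ℂ)⁻¹ • (f : L2Circle)) = f
      rw [hb, Multiset.map_zero, Multiset.prod_zero, map_smul, map_smul, smul_apply, mulOp_one,
        smul_smul, inv_mul_cancel₀ (Circle.coe_ne_zero c), one_smul]
    rw [htop, rank_subsingleton']
    simp
  | cons a s ih =>
    have hs : (c : ℂ) • (s.map blaschkeFactor).prod ∈ analyticMultiplier :=
      IsBlaschkeProduct.mem_analyticMultiplier ⟨c, s, le_rfl, rfl⟩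
    have hb' : b = blaschkeMultiplier a * ⟨_, hs⟩ := by
      refine Subtype.ext (hb.trans ?_)
      rw [Multiset.map_cons, Multiset.prod_cons, ← mul_smul_comm]
      rfl
    rw [hb', range_mulHardy_mul, rank_quotient_map
      (mulHardy_isometry (g := blaschkeMultiplier a)
        (norm_blaschkeFactor a)).injective, ih rfl, rank_quotient_range_blaschkeMultiplier]
    simp

/-! ### Invariant subspaces of finite codimension -/

/-- A closed subspace of finite positive codimension that is invariant under the shift is
annihilated by a continuous functional that is an eigenvector of the transposed shift. -/
lemma exists_functional_of_invariant {V : Submodule ℂ hardyCircle}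
    (hV : IsClosed (V : Set hardyCircle)) (hinv : ∀ f ∈ V, shiftHardy f ∈ V) {N : ℕ}
    (hN : Module.rank ℂ (hardyCircle ⧸ V) = (N + 1 : ℕ)) :
    ∃ (a : ℂ) (ℓ : hardyCircle →L[ℂ] ℂ), ℓ ≠ 0 ∧ (∀ f ∈ V, ℓ f = 0) ∧
      ∀ f, ℓ (shiftHardy f) = a * ℓ f := by
  have hfin : FiniteDimensional ℂ (hardyCircle ⧸ V) :=
    Module.rank_lt_aleph0_iff.1 (hN ▸ Cardinal.natCast_lt_aleph0)
  have hnt : Nontrivial (hardyCircle ⧸ V) := by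
    refine (rank_pos_iff_nontrivial (R := ℂ)).1 ?_
    rw [hN]
    exact Nat.cast_pos.2 N.succ_pos
  let S : Module.End ℂ (hardyCircle ⧸ V) := V.mapQ V shiftHardy.toLinearMap hinv
  obtain ⟨a, ha⟩ := Module.End.exists_eigenvalue (LinearMap.dualMap S)
  obtain ⟨m, hm⟩ := ha.exists_hasEigenvector
  have hcl : IsClosed (V : Set hardyCircle) := hV
  have hmc : Continuous m := LinearMap.continuous_of_finiteDimensional m
  refine ⟨a, ⟨m ∘ₗ V.mkQ, hmc.comp continuous_quot_mk⟩, fun h0 => hm.2 ?_, fun f hf => ?_,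
    fun f => ?_⟩
  · ext f
    exact DFunLike.congr_fun h0 f
  · change m (V.mkQ f) = 0
    rw [Submodule.mkQ_apply, (Submodule.Quotient.mk_eq_zero V).2 hf, map_zero]
  · exact DFunLike.congr_fun hm.apply_eq_smul (V.mkQ f)

/-- The eigenvalues of the transposed shift lie in the open disc: the Fourier coefficients of the
function that represents the eigenvector form a geometric progression, and tend to `0`. -/
lemma norm_lt_one_of_functional {a : ℂ} {ℓ : hardyCircle →L[ℂ] ℂ} (h0 : ℓ ≠ 0)
    (h : ∀ f, ℓ (shiftHardy f) = a * ℓ f) : ‖a‖ < 1 := by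
  by_contra! ha
  let g : hardyCircle := (InnerProductSpace.toDual ℂ hardyCircle).symm ℓ
  have hg : ∀ f : hardyCircle, inner ℂ (g : L2Circle) (f : L2Circle) = ℓ f := fun f =>
    (InnerProductSpace.toDual_symm_apply (𝕜 := ℂ) (E := hardyCircle) (x := f) (y := ℓ))
  let e : ℕ → hardyCircle := fun m => ⟨circleChar m, circleChar_mem (Int.natCast_nonneg m)⟩
  have he : ∀ m, ℓ (e m) = a ^ m * ℓ (e 0) := by
    intro m
    induction m with
    | zero => simp
    | succ m ih =>
      have h1 : e (m + 1) = shiftHardy (e m) := Subtype.ext (by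
        change circleChar _ = mulOp _ (fourier 1) (circleChar m)
        rw [mulOp_fourier_circleChar, Nat.cast_succ, add_comm])
      rw [h1, h, ih, pow_succ]
      ring
  have hlim : Filter.Tendsto (fun m : ℕ => ‖inner ℂ (circleChar m) (g : L2Circle)‖ ^ 2)
      Filter.atTop (nhds 0) :=
    ((orthonormal_circleChar.inner_products_summable (g : L2Circle)).comp_injective
      Nat.cast_injective).tendsto_atTop_zero
  have hge : ∀ m : ℕ, ‖ℓ (e 0)‖ ^ 2 ≤ ‖inner ℂ (circleChar m) (g : L2Circle)‖ ^ 2 := fun m => by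
    have h1 : ‖inner ℂ (circleChar m) (g : L2Circle)‖ = ‖ℓ (e m)‖ := by
      rw [norm_inner_symm (𝕜 := ℂ) (E := L2Circle), ← hg]
    rw [h1, he m, norm_mul, norm_pow]
    gcongr
    exact le_mul_of_one_le_left (norm_nonneg _) (one_le_pow₀ ha)
  have h00 : ℓ (e 0) = 0 := by
    have h1 := ge_of_tendsto' hlim hge
    have h2 : ‖ℓ (e 0)‖ ^ 2 = 0 := le_antisymm h1 (by positivity)
    simpa using h2
  have hg0 : g = 0 := by
    refine Subtype.ext (ext_inner_circleChar fun k => ?_)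
    rw [ZeroMemClass.coe_zero, inner_zero_right]
    rcases lt_or_ge k 0 with hk | hk
    · exact mem_hardyCircle.1 g.2 k hk
    · lift k to ℕ using hk
      rw [← inner_conj_symm, hg (e k), he, h00, mul_zero, map_zero]
  refine h0 ?_
  ext f
  rw [← hg f, hg0, ZeroMemClass.coe_zero, inner_zero_left]
  rfl

lemma mulHardy_blaschkeMultiplier_injective (a : Complex.UnitDisc) :
    Function.Injective (mulHardy (blaschkeMultiplier a)) :=
  (mulHardy_isometry (g := blaschkeMultiplier a) (norm_blaschkeFactor a)).injective

/-- A closed subspace is contained in `β H²(𝕋)` if it is annihilated by an eigenvector of the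
transposed shift: both `β H²(𝕋)` and the kernel of the eigenvector have codimension one. -/
lemma le_range_mulHardy_blaschkeMultiplier {a : Complex.UnitDisc} {ℓ : hardyCircle →L[ℂ] ℂ}
    (h0 : ℓ ≠ 0) (hℓ : ∀ f, ℓ (shiftHardy f) = a * ℓ f) {V : Submodule ℂ hardyCircle}
    (hV : ∀ f ∈ V, ℓ f = 0) :
    V ≤ LinearMap.range (mulHardy (blaschkeMultiplier a)).toLinearMap := by
  have hker : ∀ f ∈ LinearMap.range (mulHardy (blaschkeMultiplier a)).toLinearMap,
      ℓ.toLinearMap f = 0 := by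
    rw [range_mulHardy_blaschkeMultiplier]
    rintro _ ⟨u, rfl⟩
    have h1 : ℓ (shiftHardy u - (a : ℂ) • u) = 0 := by
      rw [map_sub, map_smul, hℓ, smul_eq_mul, sub_self]
    exact h1
  exact fun f hf => mem_of_functional_eq_zero (rank_quotient_range_blaschkeMultiplier a) hker
    (fun h => h0 (ContinuousLinearMap.coe_injective h)) (hV f hf)

lemma isClosed_comap_mulHardy {V : Submodule ℂ hardyCircle}
    (hV : IsClosed (V : Set hardyCircle)) (g : analyticMultiplier) :
    IsClosed (V.comap (mulHardy g).toLinearMap : Set hardyCircle) :=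
  hV.preimage (mulHardy g).continuous

lemma isBlaschkeProduct_one : IsBlaschkeProduct 0 1 :=
  ⟨1, 0, le_rfl, by simp⟩

lemma IsBlaschkeProduct.blaschkeFactor_mul {N : ℕ} {b : C(UnitAddCircle, ℂ)}
    (hb : IsBlaschkeProduct N b) (a : Complex.UnitDisc) :
    IsBlaschkeProduct (N + 1) (blaschkeFactor a * b) := by
  obtain ⟨c, s, hs, rfl⟩ := hb
  refine ⟨c, a ::ₘ s, by rw [Multiset.card_cons]; omega, ?_⟩
  rw [Multiset.map_cons, Multiset.prod_cons, mul_smul_comm]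

/-- Beurling's theorem for finite codimension: a closed subspace of codimension `N` in `H²(𝕋)`
that is invariant under the shift contains `b H²(𝕋)` for a Blaschke product `b` of degree at most
`N`. -/
lemma exists_blaschkeProduct_mul_mem (N : ℕ) {V : Submodule ℂ hardyCircle}
    (hV : IsClosed (V : Set hardyCircle)) (hinv : ∀ f ∈ V, shiftHardy f ∈ V)
    (hN : Module.rank ℂ (hardyCircle ⧸ V) = N) :
    ∃ b : analyticMultiplier, IsBlaschkeProduct N (b : C(UnitAddCircle, ℂ)) ∧
      ∀ f, mulHardy b f ∈ V := by
  induction N generalizing V with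
  | zero =>
    rw [Nat.cast_zero, rank_zero_iff, Submodule.Quotient.subsingleton_iff] at hN
    exact ⟨1, isBlaschkeProduct_one, fun f => hN ▸ Submodule.mem_top⟩
  | succ N ih =>
    obtain ⟨a, ℓ, hℓ0, hℓV, hℓ⟩ := exists_functional_of_invariant hV hinv hN
    obtain ⟨α, rfl⟩ : ∃ α : Complex.UnitDisc, (α : ℂ) = a :=
      ⟨Complex.UnitDisc.mk a (norm_lt_one_of_functional hℓ0 hℓ), Complex.UnitDisc.coe_mk _ _⟩
    have hle := le_range_mulHardy_blaschkeMultiplier hℓ0 hℓ hℓV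
    obtain ⟨b, hb, hbV⟩ := ih (isClosed_comap_mulHardy hV (blaschkeMultiplier α))
      (fun _ hf => map_mem_comap_of_commute (shiftHardy_mulHardy (blaschkeMultiplier α)) hinv hf)
      (rank_quotient_comap_toLinearMap (mulHardy_blaschkeMultiplier_injective α)
        (rank_quotient_range_blaschkeMultiplier α) hle hN)
    refine ⟨blaschkeMultiplier α * b, hb.blaschkeFactor_mul α, fun f => ?_⟩
    rw [mulHardy_mul]
    exact apply_mem_of_mem_comap (hbV f)

end Circle

/-! ### Tensor products of functions of one variable -/

section Tensor

variable {d : ℕ}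

lemma tensor_ae_congr {f g : Fin d → UnitAddCircle → ℂ}
    (h : ∀ k, f k =ᵐ[AddCircle.haarAddCircle] g k) :
    (fun x : UnitAddTorus (Fin d) => ∏ k, f k (x k)) =ᵐ[torusMeasure d]
      fun x => ∏ k, g k (x k) := by
  have h1 : ∀ k, ∀ᵐ x ∂torusMeasure d, f k (x k) = g k (x k) := fun k =>
    (measurePreserving_eval (fun _ : Fin d => (AddCircle.haarAddCircle : Measure UnitAddCircle))
      k).quasiMeasurePreserving.ae (h k)
  filter_upwards [ae_all_iff.2 h1] with x hx
  exact Finset.prod_congr rfl fun k _ => hx k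

lemma memLp_tensor (f : Fin d → L2Circle) :
    MemLp (fun x : UnitAddTorus (Fin d) => ∏ k, f k (x k)) 2 (torusMeasure d) := by
  have h1 : AEStronglyMeasurable (fun x : UnitAddTorus (Fin d) => ∏ k, f k (x k))
      (torusMeasure d) :=
    Finset.aestronglyMeasurable_fun_prod _ fun k _ =>
      (Lp.aestronglyMeasurable (f k)).comp_quasiMeasurePreserving
        (measurePreserving_eval (fun _ : Fin d =>
          (AddCircle.haarAddCircle : Measure UnitAddCircle)) k).quasiMeasurePreserving
  rw [memLp_two_iff_integrable_sq_norm h1]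
  have h2 := Integrable.fintype_prod (f := fun k t => ‖f k t‖ ^ 2)
    (μ := fun _ : Fin d => (AddCircle.haarAddCircle : Measure UnitAddCircle))
    fun k => (memLp_two_iff_integrable_sq_norm (Lp.aestronglyMeasurable (f k))).1 (Lp.memLp (f k))
  simpa only [norm_prod, ← Finset.prod_pow] using h2

/-- The tensor product `f_1 ⊗ ⋯ ⊗ f_d`, that is, `f_1(x_1) ⋯ f_d(x_d)`, in `L²(𝕋^d)`. -/
def tensorLp (f : Fin d → L2Circle) : L2Torus d := (memLp_tensor f).toLp

lemma coeFn_tensorLp (f : Fin d → L2Circle) :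
    tensorLp f =ᵐ[torusMeasure d] fun x => ∏ k, f k (x k) := MemLp.coeFn_toLp _

lemma eq_tensorLp_iff {f : Fin d → L2Circle} {F : L2Torus d} :
    F = tensorLp f ↔ F =ᵐ[torusMeasure d] fun x => ∏ k, f k (x k) :=
  ⟨fun h => h ▸ coeFn_tensorLp f, fun h => Lp.ext (h.trans (coeFn_tensorLp f).symm)⟩

lemma inner_tensorLp (f g : Fin d → L2Circle) :
    inner ℂ (tensorLp f) (tensorLp g) = ∏ k, inner ℂ (f k) (g k) := by
  simp only [L2.inner_def]
  rw [← integral_fintype_prod_eq_prod]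
  refine integral_congr_ae ?_
  filter_upwards [coeFn_tensorLp f, coeFn_tensorLp g] with x h1 h2
  rw [h1, h2]
  simp only [RCLike.inner_apply, map_prod, Finset.prod_mul_distrib]

lemma mulOp_tensorFun_tensorLp (b : Fin d → C(UnitAddCircle, ℂ)) (f : Fin d → L2Circle) :
    mulOp (torusMeasure d) (tensorFun b) (tensorLp f) =
      tensorLp fun k => mulOp AddCircle.haarAddCircle (b k) (f k) := by
  rw [eq_tensorLp_iff]
  have h1 := tensor_ae_congr fun k => coeFn_mulOp (μ := AddCircle.haarAddCircle) (b k) (f k)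
  refine (coeFn_mulOp (tensorFun b) (tensorLp f)).trans (Filter.EventuallyEq.trans ?_ h1.symm)
  filter_upwards [coeFn_tensorLp f] with x hx
  rw [hx, Finset.prod_mul_distrib, tensorFun, ContinuousMap.prod_apply]
  rfl

lemma mFourier_eq_tensorFun (n : Fin d → ℤ) :
    UnitAddTorus.mFourier n = tensorFun fun k => fourier (n k) := by
  ext x
  rw [tensorFun, ContinuousMap.prod_apply]
  rfl

lemma tensorFun_mul (b c : Fin d → C(UnitAddCircle, ℂ)) :
    tensorFun (fun k => b k * c k) = tensorFun b * tensorFun c := by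
  rw [tensorFun, tensorFun, tensorFun, ← Finset.prod_mul_distrib]
  rfl

lemma torusChar_eq_tensorLp (n : Fin d → ℤ) :
    torusChar n = tensorLp fun k => circleChar (n k) := by
  rw [eq_tensorLp_iff]
  have h1 := tensor_ae_congr fun k => ContinuousMap.coeFn_toLp (p := 2) (𝕜 := ℂ)
    (AddCircle.haarAddCircle : Measure UnitAddCircle) (fourier (n k))
  exact (ContinuousMap.coeFn_toLp (p := 2) (𝕜 := ℂ) (torusMeasure d) _).trans h1.symm

lemma tensorLp_mem_hardy (f : Fin d → hardyCircle) :
    tensorLp (fun k => (f k : L2Circle)) ∈ hardy d := by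
  rw [mem_spectralSubspace]
  intro n hn
  obtain ⟨j, hj⟩ : ∃ j, n j < 0 := by
    by_contra! h
    exact hn h
  rw [torusChar_eq_tensorLp, inner_tensorLp]
  exact Finset.prod_eq_zero (Finset.mem_univ j) (mem_hardyCircle.1 (f j).2 _ hj)

lemma tensorSubspace_eq (V : Fin d → Submodule ℂ hardyCircle) :
    tensorSubspace V = (Submodule.span ℂ {F : L2Torus d | ∃ f : Fin d → hardyCircle,
      (∀ k, f k ∈ V k) ∧ F = tensorLp fun k => (f k : L2Circle)}).topologicalClosure := by
  simp only [eq_tensorLp_iff]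
  rfl

lemma tensorLp_mem_tensorSubspace {V : Fin d → Submodule ℂ hardyCircle} {f : Fin d → hardyCircle}
    (hf : ∀ k, f k ∈ V k) : tensorLp (fun k => (f k : L2Circle)) ∈ tensorSubspace V :=
  Submodule.le_topologicalClosure _ (Submodule.subset_span ⟨f, hf, coeFn_tensorLp _⟩)

lemma tensorSubspace_le {V : Fin d → Submodule ℂ hardyCircle} {W : Submodule ℂ (L2Torus d)}
    (hW : IsClosed (W : Set (L2Torus d)))
    (h : ∀ f : Fin d → hardyCircle, (∀ k, f k ∈ V k) → tensorLp (fun k => (f k : L2Circle)) ∈ W) :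
    tensorSubspace V ≤ W := by
  rw [tensorSubspace_eq]
  refine Submodule.topologicalClosure_minimal _ (Submodule.span_le.2 ?_) hW
  rintro _ ⟨f, hf, rfl⟩
  exact h f hf

lemma tensorSubspace_le_hardy (V : Fin d → Submodule ℂ hardyCircle) :
    tensorSubspace V ≤ hardy d :=
  tensorSubspace_le (isClosed_spectralSubspace _) fun f _ => tensorLp_mem_hardy f

lemma shift_tensorLp (j : Fin d) (f : Fin d → hardyCircle) :
    shift j (tensorLp fun k => (f k : L2Circle)) =
      tensorLp fun k => (Function.update f j (shiftHardy (f j)) k : L2Circle) := by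
  rw [shift, mulL2_eq_mulOp, mFourier_eq_tensorFun, mulOp_tensorFun_tensorLp]
  congr 1
  funext k
  rcases eq_or_ne k j with rfl | hk
  · rw [Pi.single_eq_same, Function.update_self, coe_shiftHardy]
  · rw [Pi.single_eq_of_ne hk, Function.update_of_ne hk]
    have h1 : (fourier 0 : C(UnitAddCircle, ℂ)) = 1 := by ext t; exact fourier_zero
    rw [h1, mulOp_one]

lemma exists_ne_zero_mem {V : Submodule ℂ hardyCircle} {N : ℕ}
    (hN : Module.rank ℂ (hardyCircle ⧸ V) = N) : ∃ f ∈ V, f ≠ 0 := by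
  by_contra! h
  have hV : V = ⊥ := (Submodule.eq_bot_iff V).2 h
  subst hV
  rw [(Submodule.quotEquivOfEqBot ⊥ rfl).rank_eq] at hN
  have hfin : FiniteDimensional ℂ hardyCircle :=
    Module.rank_lt_aleph0_iff.1 (hN ▸ Cardinal.natCast_lt_aleph0)
  let e : ℕ → hardyCircle := fun m => ⟨circleChar m, circleChar_mem (Int.natCast_nonneg m)⟩
  have he : LinearIndependent ℂ e := by
    have h1 : LinearIndependent ℂ fun m : ℕ => circleChar m :=
      orthonormal_circleChar.linearIndependent.comp _ Nat.cast_injective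
    exact LinearIndependent.of_comp hardyCircle.subtype h1
  exact not_finite_iff_infinite.2 inferInstance he.finite

lemma inner_tensorLp_eq_zero_of_mem {V : Fin d → Submodule ℂ hardyCircle} {g : Fin d → hardyCircle}
    {j : Fin d} (hg : g j ∈ (V j)ᗮ) {F : L2Torus d} (hF : F ∈ tensorSubspace V) :
    inner ℂ (tensorLp fun k => (g k : L2Circle)) F = 0 := by
  have h1 : tensorSubspace V ≤ (ℂ ∙ tensorLp fun k => (g k : L2Circle))ᗮ := by
    refine tensorSubspace_le (Submodule.isClosed_orthogonal _) fun f hf => ?_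
    rw [Submodule.mem_orthogonal_singleton_iff_inner_right, inner_tensorLp]
    have h2 : inner ℂ (g j) (f j) = 0 := Submodule.inner_left_of_mem_orthogonal (hf j) hg
    exact Finset.prod_eq_zero (Finset.mem_univ j) h2
  exact Submodule.mem_orthogonal_singleton_iff_inner_right.1 (h1 hF)

/-- If `V_1 ⊗ ⋯ ⊗ V_d` is invariant under the shift `S_j`, then `V_j` is invariant under the shift
of `H²(𝕋)`: test with `v_1 ⊗ ⋯ ⊗ g ⊗ ⋯ ⊗ v_d`, where `g ⟂ V_j` and `v_k ∈ V_k` is nonzero. -/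
lemma shiftHardy_mem_of_shift_mem {V : Fin d → Submodule ℂ hardyCircle} {n : Fin d → ℕ}
    (hV : ∀ k, IsClosed (V k : Set hardyCircle))
    (hn : ∀ k, Module.rank ℂ (hardyCircle ⧸ V k) = n k) {j : Fin d}
    (hinv : ∀ F ∈ tensorSubspace V, shift j F ∈ tensorSubspace V) {f : hardyCircle}
    (hf : f ∈ V j) : shiftHardy f ∈ V j := by
  choose v hv hv0 using fun k => exists_ne_zero_mem (hn k)
  have : CompleteSpace (V j) := (hV j).completeSpace_coe
  rw [← Submodule.orthogonal_orthogonal (V j), Submodule.mem_orthogonal]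
  intro g hg
  have h1 := hinv _ (tensorLp_mem_tensorSubspace (f := Function.update v j f) (V := V) fun k => by
    rcases eq_or_ne k j with rfl | hk
    · rwa [Function.update_self]
    · rw [Function.update_of_ne hk]
      exact hv k)
  rw [shift_tensorLp, Function.update_self, Function.update_idem] at h1
  have h2 := inner_tensorLp_eq_zero_of_mem (g := Function.update v j g) (j := j)
    (by rwa [Function.update_self]) h1
  rw [inner_tensorLp, Finset.prod_eq_zero_iff] at h2
  obtain ⟨k, -, hk⟩ := h2
  rcases eq_or_ne k j with rfl | hkj
  · rwa [Function.update_self, Function.update_self] at hk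
  · rw [Function.update_of_ne hkj, Function.update_of_ne hkj, inner_self_eq_zero] at hk
    exact absurd (Subtype.ext hk) (hv0 k)

end Tensor

/-! ### The subspaces `b_1 H²(𝕋) ⊗ ⋯ ⊗ b_d H²(𝕋)` -/

section Upper

variable {d : ℕ}

/-- A Blaschke product of at most `N` factors times a power of `z` has exactly `N` factors. -/
lemma IsBlaschkeProduct.exists_mul_rank_eq {N : ℕ} {b : C(UnitAddCircle, ℂ)}
    (hb : IsBlaschkeProduct N b) : ∃ c, IsBlaschkeProduct N c ∧ ∃ g : analyticMultiplier,
      (g : C(UnitAddCircle, ℂ)) = c * b ∧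
      Module.rank ℂ (hardyCircle ⧸ LinearMap.range (mulHardy g).toLinearMap) = N := by
  obtain ⟨c₀, s, hs, hbs⟩ := id hb
  let r : Multiset Complex.UnitDisc := Multiset.replicate (N - s.card) 0
  have hr : r.card = N - s.card := Multiset.card_replicate _ _
  have hc : IsBlaschkeProduct N (r.map blaschkeFactor).prod :=
    ⟨1, r, by omega, by simp⟩
  refine ⟨_, hc, ⟨_, mul_mem hc.mem_analyticMultiplier hb.mem_analyticMultiplier⟩, rfl, ?_⟩
  have hprod : (r.map blaschkeFactor).prod * b =
      (c₀ : ℂ) • ((r + s).map blaschkeFactor).prod := by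
    rw [Multiset.map_add, Multiset.prod_add, hbs, mul_smul_comm]
  rw [rank_quotient_range_mulHardy c₀ (r + s) hprod, Multiset.card_add, hr, Nat.sub_add_cancel hs]

lemma shift_mem_tensorSubspace {V : Fin d → Submodule ℂ hardyCircle} {j : Fin d}
    (hV : ∀ f ∈ V j, shiftHardy f ∈ V j) {F : L2Torus d} (hF : F ∈ tensorSubspace V) :
    shift j F ∈ tensorSubspace V := by
  let T := mulOp (torusMeasure d) (UnitAddTorus.mFourier (Pi.single j 1))
  have h1 : tensorSubspace V ≤ (tensorSubspace V).comap T.toLinearMap := by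
    refine tensorSubspace_le
      ((Submodule.isClosed_topologicalClosure _).preimage T.continuous) fun f hf => ?_
    have h2 : shift j (tensorLp fun k => (f k : L2Circle)) ∈ tensorSubspace V := by
      rw [shift_tensorLp]
      refine tensorLp_mem_tensorSubspace fun k => ?_
      rcases eq_or_ne k j with rfl | hk
      · rw [Function.update_self]
        exact hV _ (hf k)
      · rw [Function.update_of_ne hk]
        exact hf k
    rw [shift, mulL2_eq_mulOp] at h2
    exact h2
  rw [shift, mulL2_eq_mulOp]
  exact h1 hF

lemma isClosed_map_of_norm_eq {E F : Type*} [NormedAddCommGroup E] [NormedSpace ℂ E]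
    [NormedAddCommGroup F] [NormedSpace ℂ F] [CompleteSpace E] {T : E →L[ℂ] F}
    (hT : ∀ f, ‖T f‖ = ‖f‖) {K : Submodule ℂ E} (hK : IsClosed (K : Set E)) :
    IsClosed (K.map T.toLinearMap : Set F) :=
  (AddMonoidHomClass.isometry_of_norm T hT).isClosedEmbedding.isClosedMap _ hK

lemma tensorSubspace_range_mulHardy_le {g : Fin d → analyticMultiplier}
    (hg : ∀ x, ‖tensorFun (fun k => (g k : C(UnitAddCircle, ℂ))) x‖ = 1) :
    tensorSubspace (fun k => LinearMap.range (mulHardy (g k)).toLinearMap) ≤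
      (hardy d).map (mulOp (torusMeasure d)
        (tensorFun fun k => (g k : C(UnitAddCircle, ℂ)))).toLinearMap := by
  refine tensorSubspace_le (isClosed_map_of_norm_eq (norm_mulOp_of_norm_one hg)
    (isClosed_spectralSubspace _)) fun f hf => ?_
  choose u hu using hf
  refine ⟨_, tensorLp_mem_hardy u, ?_⟩
  refine (mulOp_tensorFun_tensorLp _ _).trans ?_
  congr 1
  funext k
  rw [← coe_mulHardy, ← hu k]
  rfl

/-- For Blaschke products `b_k` of at most `n_k` factors there is a shift-invariant subspace of
multi-codimension `n` that is contained in `b_1 ⊗ ⋯ ⊗ b_d H²(𝕋^d)`. -/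
lemma exists_shiftInvariant_hasMultiCodim {n : Fin d → ℕ} {b : Fin d → C(UnitAddCircle, ℂ)}
    (hb : ∀ k, IsBlaschkeProduct (n k) (b k)) :
    ∃ c : Fin d → C(UnitAddCircle, ℂ), (∀ k, IsBlaschkeProduct (n k) (c k)) ∧
      ∃ I : Submodule ℂ (hardy d), ShiftInvariant I ∧ HasMultiCodim I n ∧
        ∀ f ∈ I, ∃ u : hardy d, (f : L2Torus d) =
          mulOp (torusMeasure d) (tensorFun c * tensorFun b) u := by
  choose c hc g hg hrank using fun k => (hb k).exists_mul_rank_eq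
  have hcb : tensorFun (fun k => (g k : C(UnitAddCircle, ℂ))) = tensorFun c * tensorFun b := by
    simp only [hg]
    exact tensorFun_mul c b
  have hg1 : ∀ k t, ‖(g k : C(UnitAddCircle, ℂ)) t‖ = 1 := fun k t => by
    rw [hg, ContinuousMap.mul_apply, norm_mul, (hc k).norm_apply, (hb k).norm_apply, one_mul]
  let V : Fin d → Submodule ℂ hardyCircle := fun k => LinearMap.range (mulHardy (g k)).toLinearMap
  let I : Submodule ℂ (hardy d) := (tensorSubspace V).comap (hardy d).subtype
  have hI : I.map (hardy d).subtype = tensorSubspace V :=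
    Submodule.map_comap_eq_of_le (by rw [Submodule.range_subtype]; exact tensorSubspace_le_hardy V)
  refine ⟨c, hc, I, fun j f hf => ?_,
    ⟨V, fun k => isClosed_range_mulHardy (hg1 k), hrank, hI⟩, fun f hf => ?_⟩
  · rw [hI] at hf ⊢
    refine shift_mem_tensorSubspace ?_ hf
    rintro _ ⟨u, rfl⟩
    exact ⟨shiftHardy u, (shiftHardy_mulHardy (g j) u).symm⟩
  · have hnorm : ∀ x, ‖tensorFun (fun k => (g k : C(UnitAddCircle, ℂ))) x‖ = 1 := fun x => by
      rw [hcb, ContinuousMap.mul_apply, norm_mul, norm_tensorFun_apply hc, norm_tensorFun_apply hb,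
        one_mul]
    obtain ⟨u, hu, huf⟩ := tensorSubspace_range_mulHardy_le hnorm hf
    rw [hcb] at huf
    exact ⟨⟨u, hu⟩, huf.symm⟩

end Upper

/-! ### The two estimates -/

section Main

variable {d : ℕ}

lemma norm_apply_le_of_dense {E H G : Type*} [AddCommMonoid E] [Module ℂ E]
    [NormedAddCommGroup H] [NormedSpace ℂ H] [NormedAddCommGroup G] [NormedSpace ℂ G]
    {K : Submodule ℂ H} (T : K →L[ℂ] G) (e : E →ₗ[ℂ] K) (he : DenseRange e) {C : ℝ}
    (h : ∀ p, ‖T (e p)‖ ≤ C * ‖(e p : H)‖) (f : K) : ‖T f‖ ≤ C * ‖(f : H)‖ := by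
  refine he.induction_on f (isClosed_le ?_ ?_) h
  · exact T.continuous.norm
  · exact continuous_const.mul continuous_subtype_val.norm

section Restriction

variable {H G : Type*} [NormedAddCommGroup H] [NormedSpace ℂ H] [NormedAddCommGroup G]
  [NormedSpace ℂ G] (T : H →L[ℂ] G) (I : Submodule ℂ H)

lemma enorm_comp_subtypeL_le {C : ℝ} (hC : 0 ≤ C) (h : ∀ f ∈ I, ‖T f‖ ≤ C * ‖f‖) :
    ‖T.comp I.subtypeL‖ₑ ≤ ENNReal.ofReal C := by
  rw [← ofReal_norm]
  exact ENNReal.ofReal_le_ofReal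
    ((T.comp I.subtypeL).opNorm_le_bound hC fun f => h f f.2)

lemma exists_enorm_comp_subtypeL_eq : ∃ M : ℝ, 0 ≤ M ∧
    ‖T.comp I.subtypeL‖ₑ = ENNReal.ofReal M ∧ ∀ f ∈ I, ‖T f‖ ≤ M * ‖f‖ :=
  ⟨‖T.comp I.subtypeL‖, ContinuousLinearMap.opNorm_nonneg _, (ofReal_norm _).symm,
    fun f hf => (T.comp I.subtypeL).le_opNorm ⟨f, hf⟩⟩

end Restriction

/-- If `b φ - h` has a decomposition bounded by `M`, then the Hankel operator with symbol `φ` is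
bounded by `√d * M` on the multiples of `c b`, because for an analytic polynomial `p` it maps
`c b p` to `(I - P) (c p (b φ - h))`. -/
lemma IsHankelWithSymbol.norm_apply_mulOp_le {φ : L2Torus d} {Γ : hardy d →L[ℂ] (hardy d)ᗮ}
    (hΓ : IsHankelWithSymbol φ Γ) {n : Fin d → ℕ} {b c : Fin d → C(UnitAddCircle, ℂ)}
    (hb : ∀ k, IsBlaschkeProduct (n k) (b k)) (hc : ∀ k, IsBlaschkeProduct (n k) (c k))
    {h φ₀ : L2Torus d} {ϕ : Fin d → L2Torus d} (hh : h ∈ hardy d)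
    (hdec : IsBMOrDecomp (mulOp (torusMeasure d) (tensorFun b) φ - h) φ₀ ϕ) {M : ℝ} (hM : 0 ≤ M)
    (hϕ : ∀ j, eLpNorm (ϕ j) ∞ (torusMeasure d) ≤ ENNReal.ofReal M) {f u : hardy d}
    (hf : (f : L2Torus d) = mulOp (torusMeasure d) (tensorFun c * tensorFun b) u) :
    ‖Γ f‖ ≤ √d * M * ‖f‖ := by
  have hmem : ∀ u ∈ hardy d, mulOp (torusMeasure d) (tensorFun c * tensorFun b) u ∈ hardy d :=
    fun u hu => by
      rw [mulOp_mul]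
      exact mulOp_tensorFun_mem_hardy hc (mulOp_tensorFun_mem_hardy hb hu)
  have hnorm : ∀ x, ‖(tensorFun c * tensorFun b) x‖ = 1 := fun x => by
    rw [ContinuousMap.mul_apply, norm_mul, norm_tensorFun_apply hc, norm_tensorFun_apply hb,
      one_mul]
  let B : hardy d →L[ℂ] hardy d :=
    (mulOp (torusMeasure d) (tensorFun c * tensorFun b)).restrict hmem
  have hfB : f = B u := Subtype.ext hf
  have hfu : ‖f‖ = ‖u‖ := by
    have h1 := norm_mulOp_of_norm_one hnorm (u : L2Torus d)
    rwa [← hf] at h1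
  rw [hfu, hfB]
  refine norm_apply_le_of_dense (Γ.comp B) (polyToHardy d) (denseRange_polyToHardy d)
    (fun p => ?_) u
  have h1 : (B (polyToHardy d p) : L2Torus d) =
      ContinuousMap.toLp 2 (torusMeasure d) ℂ (tensorFun c * tensorFun b * (p : C(_, ℂ))) :=
    mulOp_toLp _ _
  have h2 := hΓ.apply_of_coe_eq h1
  have hpres : ∀ j, ∀ f ∈ hardyIn j,
      mulOp (torusMeasure d) (tensorFun c * (p : C(_, ℂ))) f ∈ hardyIn j := fun j f hf => by
    rw [mulOp_mul]
    exact mulOp_tensorFun_mem_hardyIn hc j (mulOp_mem_hardyIn p.2 j hf)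
  have h3 := norm_sub_projH2_le hdec hM hϕ hpres
  have h4 : mulOp (torusMeasure d) (tensorFun c * (p : C(_, ℂ))) h ∈ hardy d :=
    mem_hardy_iff.2 fun j => hpres j h (hardy_le_hardyIn j hh)
  have h5 : projH2 d (mulOp (torusMeasure d) (tensorFun c * (p : C(_, ℂ))) h) =
      mulOp (torusMeasure d) (tensorFun c * (p : C(_, ℂ))) h := starProjection_eq_self h4
  have h6 : tensorFun c * tensorFun b * (p : C(_, ℂ)) = tensorFun c * (p : C(_, ℂ)) * tensorFun b :=
    mul_right_comm _ _ _
  rw [map_sub, map_sub, h5, sub_sub_sub_cancel_right, ← mulOp_mul, ← h6, ← h2, ← mulOp_toLp,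
    norm_mulOp_of_norm_one (norm_tensorFun_apply hc)] at h3
  exact h3

lemma ofReal_mul_sigmaNumber_le {n : Fin d → ℕ} {φ : L2Torus d} {Γ : hardy d →L[ℂ] (hardy d)ᗮ}
    (hd : 0 < d) (hΓ : IsHankelWithSymbol φ Γ) :
    ENNReal.ofReal (1 / √(d : ℝ)) * sigmaNumber n Γ ≤ deltaDist n φ := by
  refine le_iInf₂ fun b hb => le_iInf₂ fun h hh => le_iInf₂ fun φ₀ ϕ => le_iInf fun hdec => ?_
  set X := max (eLpNorm φ₀ ∞ (torusMeasure d)) (⨆ j, eLpNorm (ϕ j) ∞ (torusMeasure d)) with hX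
  rcases eq_or_ne X ∞ with hXt | hXt
  · rw [hXt]
    exact le_top
  rw [mulL2_eq_mulOp] at hdec
  obtain ⟨c, hc, I, hI, hIn, hIf⟩ := exists_shiftInvariant_hasMultiCodim hb
  have hϕ : ∀ j, eLpNorm (ϕ j) ∞ (torusMeasure d) ≤ ENNReal.ofReal X.toReal := fun j => by
    rw [ENNReal.ofReal_toReal hXt]
    exact (le_iSup (fun j => eLpNorm (ϕ j) ∞ (torusMeasure d)) j).trans (le_max_right _ _)
  have hσ : sigmaNumber n Γ ≤ ENNReal.ofReal (√d * X.toReal) := by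
    refine (iInf₂_le I hI).trans ((iInf_le _ hIn).trans
      (enorm_comp_subtypeL_le Γ I (by positivity) fun f hf => ?_))
    obtain ⟨u, hu⟩ := hIf f hf
    exact hΓ.norm_apply_mulOp_le hb hc hh.2 hdec ENNReal.toReal_nonneg hϕ hu
  have hd0 : √(d : ℝ) ≠ 0 := by positivity
  calc ENNReal.ofReal (1 / √(d : ℝ)) * sigmaNumber n Γ
      ≤ ENNReal.ofReal (1 / √(d : ℝ)) * ENNReal.ofReal (√d * X.toReal) := by gcongr
    _ = X := by
      rw [← ENNReal.ofReal_mul (by positivity), ← mul_assoc, one_div, inv_mul_cancel₀ hd0, one_mul,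
        ENNReal.ofReal_toReal hXt]

lemma sigmaNumber_ne_top (n : Fin d → ℕ) (Γ : hardy d →L[ℂ] (hardy d)ᗮ) :
    sigmaNumber n Γ ≠ ∞ := by
  have h1 : ∀ k, IsBlaschkeProduct (n k) 1 := fun k => ⟨1, 0, Nat.zero_le _, by simp⟩
  obtain ⟨-, -, I, hI, hIn, -⟩ := exists_shiftInvariant_hasMultiCodim h1
  exact ((iInf₂_le I hI).trans (iInf_le _ hIn)).trans_lt enorm_lt_top |>.ne

/-- By Beurling's theorem the factors of a shift-invariant subspace of multi-codimension `n` contain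
`b_k H²(𝕋)`, so it contains the products of the analytic polynomials with `b_1 ⊗ ⋯ ⊗ b_d`. -/
lemma exists_tensorFun_mul_mem {n : Fin d → ℕ} {I : Submodule ℂ (hardy d)}
    (hI : ShiftInvariant I) (hIn : HasMultiCodim I n) :
    ∃ b : Fin d → C(UnitAddCircle, ℂ), (∀ k, IsBlaschkeProduct (n k) (b k)) ∧
      ∀ p ∈ analyticPoly d, ∃ f ∈ I, (f : L2Torus d) =
        ContinuousMap.toLp 2 (torusMeasure d) ℂ (tensorFun b * p) := by
  obtain ⟨V, hVc, hVn, hIV⟩ := hIn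
  have hinv : ∀ k, ∀ f ∈ V k, shiftHardy f ∈ V k := fun k f hf =>
    shiftHardy_mem_of_shift_mem hVc hVn (fun F hF => by
      have h := hI k F
      rw [hIV] at h
      exact h hF) hf
  choose b hb hbV using fun k => exists_blaschkeProduct_mul_mem (n k) (hVc k) (hinv k) (hVn k)
  refine ⟨fun k => b k, hb, fun p hp => ?_⟩
  have key : ContinuousMap.toLp 2 (torusMeasure d) ℂ
      (tensorFun (fun k => (b k : C(UnitAddCircle, ℂ))) * p) ∈ tensorSubspace V := by
    let T := (mulOp (torusMeasure d) (tensorFun fun k => (b k : C(UnitAddCircle, ℂ)))).comp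
      (ContinuousMap.toLp (E := ℂ) 2 (torusMeasure d) ℂ)
    have h1 : analyticPoly d ≤ (tensorSubspace V).comap T.toLinearMap := by
      refine Submodule.span_le.2 ?_
      rintro _ ⟨k, hk, rfl⟩
      have hk' : ∀ j, 0 ≤ k j := hk
      have h2 : mulOp (torusMeasure d) (tensorFun fun k => (b k : C(UnitAddCircle, ℂ)))
          (torusChar k) ∈ tensorSubspace V := by
        rw [torusChar_eq_tensorLp, mulOp_tensorFun_tensorLp]
        exact tensorLp_mem_tensorSubspace fun j => hbV j ⟨circleChar (k j), circleChar_mem (hk' j)⟩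
      exact h2
    rw [← mulOp_toLp]
    exact h1 hp
  rw [← hIV] at key
  obtain ⟨f, hf, hfe⟩ := key
  exact ⟨f, hf, hfe⟩

lemma deltaDist_le_sigmaNumber {n : Fin d → ℕ} {φ : L2Torus d} (hφ : MemBMOr φ)
    {Γ : hardy d →L[ℂ] (hardy d)ᗮ} (hΓ : IsHankelWithSymbol φ Γ) :
    deltaDist n φ ≤ sigmaNumber n Γ := by
  refine le_iInf₂ fun I hI => le_iInf fun hIn => ?_
  obtain ⟨b, hb, hbI⟩ := exists_tensorFun_mul_mem hI hIn
  obtain ⟨M, hM0, hM, hΓM⟩ := exists_enorm_comp_subtypeL_eq Γ I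
  refine le_of_le_of_eq ?_ hM.symm
  set ψ : L2Torus d := mulOp (torusMeasure d) (tensorFun b) φ with hψ
  have h1 : ∀ p ∈ analyticPoly d,
      ‖mulOp (torusMeasure d) p ψ - projH2 d (mulOp (torusMeasure d) p ψ)‖ ≤
        M * ‖ContinuousMap.toLp 2 (torusMeasure d) ℂ p‖ := fun p hp => by
    obtain ⟨f, hf, hfe⟩ := hbI p hp
    have h2 := hΓ.apply_of_coe_eq hfe
    have h3 : ‖(Γ f : L2Torus d)‖ ≤ M * ‖(f : L2Torus d)‖ := hΓM f hf
    rwa [h2, hfe, ← mulOp_toLp, norm_mulOp_of_norm_one (norm_tensorFun_apply hb), mul_comm,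
      mulOp_mul, ← hψ] at h3
  choose ϕ hϕM hϕ using fun j => exists_bounded_of_norm_sub_projIn_le hM0
    fun p (hp : p ∈ polySpace {k : Fin d → ℤ | 0 ≤ k j}) =>
      norm_sub_projIn_le_of_norm_sub_projH2_le h1 j hp
  have h2 : MemBMOr ψ := hφ.mulOp_tensorFun hb
  obtain ⟨ψ₀, ϕ', h2⟩ := h2
  have hh : MemBMOAr (projH2 d ψ) := by
    refine ⟨⟨ψ₀, fun _ => 0, h2.memLp_zero, fun _ => ?_, fun j => ?_, ?_⟩, projH2_mem ψ⟩
    · exact (memLp_congr_ae (Lp.coeFn_zero ℂ 2 (torusMeasure d))).2 MemLp.zero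
    · rw [sub_projIn_eq_iff, sub_zero]
      exact hardy_le_hardyIn j (projH2_mem ψ)
    · rw [← h2.analytic, projAll_eq_projH2]
      exact starProjection_eq_self (projH2_mem ψ)
  have hdec : IsBMOrDecomp (ψ - projH2 d ψ) 0 ϕ := by
    refine ⟨?_, fun j => ?_, fun j => ?_, ?_⟩
    · exact (memLp_congr_ae (Lp.coeFn_zero ℂ 2 (torusMeasure d))).2 MemLp.zero
    · exact ⟨Lp.aestronglyMeasurable (ϕ j), (hϕM j).trans_lt ENNReal.ofReal_lt_top⟩
    · rw [sub_projIn_sub_projH2, hϕ j]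
    · rw [projAll_eq_projH2, map_sub, map_zero, sub_eq_zero]
      exact (starProjection_eq_self (projH2_mem ψ)).symm
  refine (iInf₂_le b hb).trans ((iInf₂_le (projH2 d ψ) hh).trans ?_)
  rw [mulL2_eq_mulOp, ← hψ]
  refine (iInf₂_le 0 ϕ).trans ((iInf_le _ hdec).trans (max_le ?_ (iSup_le hϕM)))
  rw [eLpNorm_congr_ae (Lp.coeFn_zero ℂ 2 (torusMeasure d)), eLpNorm_zero]
  exact zero_le

end Main

end

theorem theorem3p3 (d : ℕ) (hd : 1 < d) (n : Fin d → ℕ) (φ : L2Torus d) (hφ : MemBMOr φ) :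
    (∃! Γ : hardy d →L[ℂ] (hardy d)ᗮ, IsHankelWithSymbol φ Γ) ∧
    ∀ Γ : hardy d →L[ℂ] (hardy d)ᗮ, IsHankelWithSymbol φ Γ →
      sigmaNumber n Γ ≠ ∞ ∧
      ENNReal.ofReal (1 / √(d : ℝ)) * sigmaNumber n Γ ≤ deltaDist n φ ∧
      deltaDist n φ ≤ sigmaNumber n Γ := by
  obtain ⟨Γ, hΓ⟩ := exists_isHankelWithSymbol hφ
  exact ⟨⟨Γ, hΓ, fun Γ' hΓ' => hΓ'.unique hΓ⟩, fun Γ hΓ => ⟨sigmaNumber_ne_top n Γ,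
    ofReal_mul_sigmaNumber_le (zero_lt_one.trans hd) hΓ, deltaDist_le_sigmaNumber hφ hΓ⟩⟩
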